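/- Let $m,n,l\ge 1$ be integers, $\mathcal V=\{1,\dots,m\}$ a set of agents, and $\Theta\in\mathbb R^{l\times n}$ an unknown matrix. For each agent $i\in\mathcal V$ and time $t=1,2,\dots$ let $y_{i,t}=\Theta x_{i,t}+\eta_{i,t}$, where all the random vectors $x_{i,t}\sim\mathcal N(\mu_{i,t},\sigma_x^2 I_n)$ and $\eta_{i,t}\sim\mathcal N(0,\sigma_\eta^2 I_l)$ are mutually independent (over agents and times, and features independent of noises), $\sigma_x>0$, $\sigma_\eta\ge 0$, and the means $\mu_{i,t}\in\mathbb R^n$ are deterministic with $\hat\mu=\sup\{\|\mu_{i,t}\| : i\in\mathcal V,\ t\ge 1\}<\infty$. The local least-squares estimate of agent $i$ from its first $t$ samples is $$\hat\Theta_{i,t+1}=\Big(\sum_{j=1}^t y_{i,j}x_{i,j}^{*}\Big)\Big(\sum_{j=1}^t x_{i,j}x_{i,j}^{*}\Big)^{-1},$$ defined when $\sum_{j=1}^t x_{i,j}x_{i,j}^{*}$ is invertible. Write $\|\cdot\|$ for the spectral norm of a matrix and $\lambda_{\min}$ for the smallest eigenvalue. Theorem 1. Fix $\delta>0$ and let $t\ge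 1$ be an integer with $t\ge\max(t_1,t_2,t_3)$, where $$t_1=8n+16\log\tfrac{2}{\delta},\qquad t_2=\Big(\frac{16\hat\mu\big(\sqrt{4n}+\sqrt{2\log\frac{2}{\delta}}\big)}{\sigma_x}\Big)^2,\qquad t_3=2(n+l)\log\tfrac{1}{\delta}.$$ For any $i\in\mathcal V$, let $\bar\mu_{i,t}=\frac{4}{t\sigma_x^2}\sum_{j=1}^t\mu_{i,j}\mu_{i,j}^{*}$. Then with probability at least $1-4\delta$ the matrix $\sum_{j=1}^t x_{i,j}x_{i,j}^{*}$ is invertible and $$\|\hat\Theta_{i,t+1}-\Theta\|\le\frac{C_1}{\sqrt t\,\sigma_x^2\,\lambda_{\min}(I_n+\bar\mu_{i,t})},$$ where $$C_1=8\sigma_\eta\Big(4\sigma_x\sqrt{(n+l)\log\tfrac{9}{\delta}}+\hat\mu\big(\sqrt{2(l+n)}+2\sqrt{\log\tfrac{2}{\delta}}\big)\Big).$$ (For $\delta\ge\frac14$ the claim is vacuous, so square roots of negative logarithms play no role.) -/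

import Mathlib

open MeasureTheory ProbabilityTheory
open scoped Matrix Matrix.Norms.L2Operator

/-- The smallest eigenvalue of a real square matrix. It is only applied to the symmetric positive
definite matrix `I + μ̄`; on symmetric positive semidefinite matrices it is the smallest eigenvalue
and also the eigenvalue of smallest magnitude, see `lambdaMin_spec`. -/
noncomputable def lambdaMin {n : ℕ} (A : Matrix (Fin n) (Fin n) ℝ) : ℝ :=
  sInf (spectrum ℝ A)

theorem lambdaMin_spec {n : ℕ} (hn : 0 < n) (A : Matrix (Fin n) (Fin n) ℝ) (hA : A.PosSemidef) :
    lambdaMin A ∈ spectrum ℝ A ∧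
      ∀ ν ∈ spectrum ℝ A, lambdaMin A ≤ ν ∧ |lambdaMin A| ≤ |ν| := by
  have : Nonempty (Fin n) := ⟨⟨0, hn⟩⟩
  have hs : spectrum ℝ A = Set.range hA.isHermitian.eigenvalues :=
    hA.isHermitian.spectrum_real_eq_range_eigenvalues
  have hfin : (spectrum ℝ A).Finite := by
    rw [hs]; exact Set.finite_range _
  have hne : (spectrum ℝ A).Nonempty := by
    rw [hs]; exact Set.range_nonempty _
  have hnonneg : ∀ ν ∈ spectrum ℝ A, 0 ≤ ν := by
    intro ν hν
    rw [hs] at hν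
    obtain ⟨k, rfl⟩ := hν
    exact hA.eigenvalues_nonneg k
  have hmem : lambdaMin A ∈ spectrum ℝ A := hne.csInf_mem hfin
  refine ⟨hmem, fun ν hν => ?_⟩
  have hle : lambdaMin A ≤ ν := csInf_le hfin.bddBelow hν
  refine ⟨hle, ?_⟩
  rw [abs_of_nonneg (hnonneg _ hmem), abs_of_nonneg (hnonneg _ hν)]
  exact hle

/-- `∑_{j=1}^t u_j v_jᵀ`, for sequences of vectors `u_1, u_2, …` and `v_1, v_2, …`. -/
noncomputable def outerSum {p q : ℕ} (u : ℕ+ → EuclideanSpace ℝ (Fin p))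
    (v : ℕ+ → EuclideanSpace ℝ (Fin q)) (t : ℕ+) : Matrix (Fin p) (Fin q) ℝ :=
  ∑ j ∈ Finset.Icc 1 t, Matrix.vecMulVec (u j).ofLp (v j).ofLp

/-- The least squares estimate `Θ̂_{t+1} = (∑_{j=1}^t y_j x_jᵀ) (∑_{j=1}^t x_j x_jᵀ)⁻¹` computed from
the features `x_1, …, x_t` and the labels `y_1, …, y_t`; it is meaningful when
`∑_{j=1}^t x_j x_jᵀ` is invertible. -/
noncomputable def lsEstimate {n l : ℕ} (x : ℕ+ → EuclideanSpace ℝ (Fin n))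
    (y : ℕ+ → EuclideanSpace ℝ (Fin l)) (t : ℕ+) : Matrix (Fin l) (Fin n) ℝ :=
  outerSum y x t * (outerSum x x t)⁻¹

/-- `μ̄_t = 4 / (t σ_x²) ∑_{j=1}^t μ_j μ_jᵀ`. -/
noncomputable def muBar {n : ℕ} (σx : ℝ) (μ : ℕ+ → EuclideanSpace ℝ (Fin n)) (t : ℕ+) :
    Matrix (Fin n) (Fin n) ℝ :=
  (4 / (((t : ℕ) : ℝ) * σx ^ 2)) • outerSum μ μ t

/-- The constant `C₁` of the local error bound. -/
noncomputable def constC1 (n l : ℕ) (σx ση μhat δ : ℝ) : ℝ :=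
  8 * ση * (4 * σx * √(((n : ℝ) + l) * Real.log (9 / δ))
    + μhat * (√(2 * ((l : ℝ) + n)) + 2 * √(Real.log (2 / δ))))

/-! When the Gram matrix `∑ x xᵀ` is invertible, the error is `(∑ η xᵀ)(∑ x xᵀ)⁻¹`. So a lower bound
`c` on the quadratic form of the Gram matrix and an upper bound `K` on the bilinear form of `∑ η xᵀ`
give an error of at most `K / c`. Write `x = μ + σx g` and `η = ση z` with `g`, `z` standard
Gaussian. Four events of total probability at most `3δ` must be excluded: `∑ ⟨g,u⟩² < t/4` for some
unit `u`; `∑ g μᵀ` large; `∑ z gᵀ` large; `∑ z μᵀ` large.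

The two terms containing `μ` are linear in the Gaussians, so their Frobenius norms are weighted
chi-square variables, handled by Chernoff (`measure_sum_norm_sq_gt_le`). The other two need
uniformity over directions, obtained without nets by a PAC-Bayes argument
(`measure_exists_setAverage_gt_le`): if `exp (f θ)` has mean at most 1 for each `θ`, then with
probability `1 - δ` every average of `f` over a small ball about a point of the unit ball is bounded
by a volume-ratio entropy plus `log (1/δ)`. Averages of bilinear forms equal their central values;
for quadratic forms the excess is isotropic and is paid for by a term `κ‖g‖²` put into `f`. -/

/-! ### Exponential integrals of standard Gaussians -/

theorem lintegral_pi_prod {ι : Type*} [Fintype ι] {X : ι → Type*} [∀ i, MeasurableSpace (X i)]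
    (μ : ∀ i, Measure (X i)) [∀ i, IsProbabilityMeasure (μ i)] (f : ∀ i, X i → ENNReal)
    (hf : ∀ i, Measurable (f i)) :
    ∫⁻ x, ∏ i, f i (x i) ∂(Measure.pi μ) = ∏ i, ∫⁻ x, f i x ∂(μ i) := by
  rw [lintegral_prod_eq_prod_lintegral_of_indepFun (μ := Measure.pi μ) Finset.univ
    (fun i x => f i (x i)) (iIndepFun_pi fun i => (hf i).aemeasurable)
    (fun i => (hf i).comp (measurable_pi_apply i))]
  exact Finset.prod_congr rfl fun i _ =>
    (measurePreserving_eval μ i).lintegral_comp (hf i)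

theorem lintegral_exp_mul_sq_gaussianReal {a : ℝ} (ha : a < 1 / 2) :
    ∫⁻ z, ENNReal.ofReal (Real.exp (a * z ^ 2)) ∂(gaussianReal 0 1)
      = ENNReal.ofReal (√(1 - 2 * a))⁻¹ := by
  rw [gaussianReal_of_var_ne_zero _ one_ne_zero,
    lintegral_withDensity_eq_lintegral_mul _ (by fun_prop) (by fun_prop)]
  have hb : 0 < 1 / 2 - a := by linarith
  have h : ∀ z : ℝ, (gaussianPDF 0 1 * fun z => ENNReal.ofReal (Real.exp (a * z ^ 2))) z
      = ENNReal.ofReal ((√(2 * Real.pi))⁻¹ * Real.exp (-(1 / 2 - a) * z ^ 2)) := by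
    intro z
    rw [Pi.mul_apply, gaussianPDF, ← ENNReal.ofReal_mul (gaussianPDFReal_nonneg _ _ _),
      gaussianPDFReal, mul_assoc, ← Real.exp_add]
    congr 3
    · simp
    · simp; ring
  simp_rw [h]
  rw [← ofReal_integral_eq_lintegral_ofReal ((integrable_exp_neg_mul_sq hb).const_mul _)
    (ae_of_all _ fun z => by positivity), integral_const_mul, integral_gaussian,
    ← Real.sqrt_inv, ← Real.sqrt_mul (by positivity), ← Real.sqrt_inv]
  congr 2
  have := Real.pi_pos
  field_simp

theorem lintegral_exp_inner_stdGaussian {E : Type*} [NormedAddCommGroup E] [InnerProductSpace ℝ E]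
    [FiniteDimensional ℝ E] [MeasurableSpace E] [BorelSpace E] (v : E) :
    ∫⁻ g, ENNReal.ofReal (Real.exp (inner ℝ v g)) ∂(stdGaussian E)
      = ENNReal.ofReal (Real.exp (‖v‖ ^ 2 / 2)) := by
  have hmap : (stdGaussian E).map (innerSL ℝ v) = gaussianReal 0 (‖v‖ ^ 2).toNNReal := by
    rw [IsGaussian.map_eq_gaussianReal, integral_strongDual_stdGaussian,
      variance_dual_stdGaussian, innerSL_apply_norm]
  have h1 : ∫⁻ g, ENNReal.ofReal (Real.exp (inner ℝ v g)) ∂(stdGaussian E)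
      = ∫⁻ z, ENNReal.ofReal (Real.exp z) ∂(gaussianReal 0 (‖v‖ ^ 2).toNNReal) := by
    rw [← hmap, lintegral_map (by fun_prop) (by fun_prop)]
    rfl
  have hi := integrable_exp_mul_gaussianReal (μ := 0) (v := (‖v‖ ^ 2).toNNReal) 1
  have hm := congrFun (mgf_id_gaussianReal (μ := 0) (v := (‖v‖ ^ 2).toNNReal)) 1
  simp only [one_mul] at hi
  simp only [mgf, id, one_mul] at hm
  rw [h1, ← ofReal_integral_eq_lintegral_ofReal hi (ae_of_all _ fun z => (Real.exp_pos _).le), hm]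
  congr 2
  simp

/-- Any two vectors of the same norm are related by a linear isometry. -/
theorem exists_linearIsometryEquiv_apply_eq {E : Type*} [NormedAddCommGroup E]
    [InnerProductSpace ℝ E] [FiniteDimensional ℝ E] {v w : E} (h : ‖v‖ = ‖w‖) :
    ∃ R : E ≃ₗᵢ[ℝ] E, R v = w :=
  ⟨(ℝ ∙ (v - w))ᗮ.reflection, Submodule.reflection_sub h⟩

/-- By rotation invariance `θ` may be taken along a coordinate axis. The integrand then factorises:
one coordinate has exponent `κ - c‖θ‖²`, the other `n - 1` have `κ`. Negative `c` is allowed and is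
used for products of Gaussians. -/
theorem lintegral_exp_quadratic_stdGaussian {n : ℕ} (i₀ : Fin n) {κ c : ℝ}
    (θ : EuclideanSpace ℝ (Fin n)) (hκ : κ < 1 / 2) (hc : κ - c * ‖θ‖ ^ 2 < 1 / 2) :
    ∫⁻ g, ENNReal.ofReal (Real.exp (κ * ‖g‖ ^ 2 - c * (inner ℝ θ g) ^ 2))
        ∂(stdGaussian (EuclideanSpace ℝ (Fin n)))
      = ENNReal.ofReal ((√(1 - 2 * (κ - c * ‖θ‖ ^ 2)))⁻¹ * (√(1 - 2 * κ))⁻¹ ^ (n - 1)) := by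
  obtain ⟨R, hR⟩ := exists_linearIsometryEquiv_apply_eq
    (v := θ) (w := EuclideanSpace.single i₀ ‖θ‖) (by simp)
  have h1 : ∀ g, ENNReal.ofReal (Real.exp (κ * ‖g‖ ^ 2 - c * (inner ℝ θ g) ^ 2))
      = (fun g : EuclideanSpace ℝ (Fin n) => ENNReal.ofReal
          (Real.exp (κ * ‖g‖ ^ 2 - c * (‖θ‖ * g i₀) ^ 2))) (R g) := by
    intro g
    have : inner ℝ θ g = ‖θ‖ * (R g) i₀ := by
      rw [← R.inner_map_map, hR, EuclideanSpace.inner_single_left]; simp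
    simp only [this, R.norm_map]
  simp_rw [h1]
  rw [← lintegral_map (f := fun g : EuclideanSpace ℝ (Fin n) => ENNReal.ofReal
          (Real.exp (κ * ‖g‖ ^ 2 - c * (‖θ‖ * g i₀) ^ 2))) (g := R)
      (by fun_prop) R.continuous.measurable,
    stdGaussian_map, ← map_pi_eq_stdGaussian, lintegral_map (by fun_prop) (by fun_prop)]
  have h2 : ∀ z : Fin n → ℝ, ENNReal.ofReal (Real.exp (κ * ‖WithLp.toLp 2 z‖ ^ 2
        - c * (‖θ‖ * (WithLp.toLp 2 z) i₀) ^ 2))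
      = ∏ i, ENNReal.ofReal (Real.exp ((if i = i₀ then κ - c * ‖θ‖ ^ 2 else κ) * (z i) ^ 2)) := by
    intro z
    rw [← ENNReal.ofReal_prod_of_nonneg (fun i _ => (Real.exp_pos _).le), ← Real.exp_sum,
      EuclideanSpace.real_norm_sq_eq]
    congr 2
    have : ∀ i, (if i = i₀ then κ - c * ‖θ‖ ^ 2 else κ) * (z i) ^ 2
        = κ * z i ^ 2 - if i = i₀ then c * ‖θ‖ ^ 2 * (z i) ^ 2 else 0 := by
      intro i; split_ifs <;> ring
    simp_rw [this, Finset.sum_sub_distrib, ← Finset.mul_sum]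
    simp; ring
  simp_rw [h2]
  rw [lintegral_pi_prod (fun _ => gaussianReal 0 1)
    (fun i z => ENNReal.ofReal (Real.exp ((if i = i₀ then κ - c * ‖θ‖ ^ 2 else κ) * z ^ 2)))
    (fun i => by fun_prop), ← Finset.mul_prod_erase Finset.univ _ (Finset.mem_univ i₀)]
  rw [ENNReal.ofReal_mul (by positivity), ENNReal.ofReal_pow (by positivity)]
  congr 1
  · simp only [if_true]
    exact lintegral_exp_mul_sq_gaussianReal hc
  · rw [Finset.prod_congr rfl (g := fun _ => ENNReal.ofReal (√(1 - 2 * κ))⁻¹)]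
    · simp
    · intro i hi
      simp only [if_neg (Finset.ne_of_mem_erase hi)]
      exact lintegral_exp_mul_sq_gaussianReal hκ

/-! ### PAC-Bayes bound and averages over balls -/

/-- A PAC-Bayes bound: Lebesgue measure on a ball as prior, uniform measures on small balls as
posteriors. -/
theorem measure_exists_setAverage_gt_le {Ω V : Type*} [MeasurableSpace Ω] (P : Measure Ω)
    [IsProbabilityMeasure P] [NormedAddCommGroup V] [NormedSpace ℝ V] [FiniteDimensional ℝ V]
    [MeasurableSpace V] [BorelSpace V] (vol : Measure V) [vol.IsAddHaarMeasure] {r δ : ℝ}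
    (hr : 0 < r) (hδ : 0 < δ) (f : Ω → V → ℝ) (hf : Measurable (Function.uncurry f))
    (hfc : ∀ ω, Continuous (f ω))
    (hexp : ∀ θ, ‖θ‖ ≤ 1 + r → ∫⁻ ω, ENNReal.ofReal (Real.exp (f ω θ)) ∂P ≤ 1) :
    P {ω | ∃ u, ‖u‖ ≤ 1 ∧ Module.finrank ℝ V * Real.log ((1 + r) / r) + Real.log (1 / δ)
        < ⨍ θ in Metric.closedBall u r, f ω θ ∂vol} ≤ ENNReal.ofReal δ := by
  set B := vol (Metric.closedBall (0 : V) (1 + r)) with hB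
  have hB0 : B ≠ 0 := (Metric.measure_closedBall_pos vol _ (by linarith)).ne'
  have hBt : B ≠ ⊤ := measure_closedBall_lt_top.ne
  set I : Ω → ENNReal := fun ω =>
    ∫⁻ θ in Metric.closedBall (0 : V) (1 + r), ENNReal.ofReal (Real.exp (f ω θ)) ∂vol with hI
  have hmeas : Measurable (Function.uncurry fun ω θ => ENNReal.ofReal (Real.exp (f ω θ))) := by
    exact ENNReal.measurable_ofReal.comp (Real.measurable_exp.comp hf)
  have hIm : Measurable I := hmeas.lintegral_prod_right'
  -- Tonelli: the moment bound at each `θ` gives one at the level of the whole ball, to which Markov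
  -- applies once for all `u`.
  have hIint : ∫⁻ ω, I ω ∂P ≤ B := by
    rw [hI, lintegral_lintegral_swap hmeas.aemeasurable]
    calc ∫⁻ θ in Metric.closedBall (0 : V) (1 + r), ∫⁻ ω, ENNReal.ofReal (Real.exp (f ω θ)) ∂P ∂vol
        ≤ ∫⁻ θ in Metric.closedBall (0 : V) (1 + r), 1 ∂vol :=
          setLIntegral_mono measurable_const fun θ hθ => hexp θ (by simpa using hθ)
      _ = B := by simp [hB]
  have hδ0 : ENNReal.ofReal δ ≠ 0 := by simpa using hδ
  have hmark : P {ω | B / ENNReal.ofReal δ ≤ I ω} ≤ ENNReal.ofReal δ := by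
    refine (meas_ge_le_lintegral_div hIm.aemeasurable
      (ENNReal.div_ne_zero.2 ⟨hB0, ENNReal.ofReal_ne_top⟩) (ENNReal.div_ne_top hBt hδ0)).trans ?_
    refine ENNReal.div_le_of_le_mul (hIint.trans ?_)
    rw [mul_comm, ENNReal.div_mul_cancel hδ0 ENNReal.ofReal_ne_top]
  refine (measure_mono ?_).trans hmark
  rintro ω ⟨u, hu, hlt⟩
  have hc : IsCompact (Metric.closedBall u r) := isCompact_closedBall u r
  have hfi : IntegrableOn (f ω) (Metric.closedBall u r) vol :=
    (hfc ω).continuousOn.integrableOn_compact hc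
  have hei : IntegrableOn (fun θ => Real.exp (f ω θ)) (Metric.closedBall u r) vol :=
    (Real.continuous_exp.comp (hfc ω)).continuousOn.integrableOn_compact hc
  have hb0 : vol (Metric.closedBall u r) ≠ 0 := (Metric.measure_closedBall_pos vol _ hr).ne'
  have hbt : vol (Metric.closedBall u r) ≠ ⊤ := measure_closedBall_lt_top.ne
  -- Jensen plays the role of the entropy inequality: the relative entropy of the small ball in the
  -- large one is the log of the volume ratio `((1 + r) / r) ^ d`, with `d` the dimension.
  have hJ : Real.exp (⨍ θ in Metric.closedBall u r, f ω θ ∂vol)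
      ≤ ⨍ θ in Metric.closedBall u r, Real.exp (f ω θ) ∂vol :=
    convexOn_exp.map_set_average_le Real.continuous_exp.continuousOn isClosed_univ hb0 hbt
      (by simp) hfi hei
  have hsub : Metric.closedBall u r ⊆ Metric.closedBall (0 : V) (1 + r) :=
    Metric.closedBall_subset_closedBall' (by simpa [add_comm] using hu)
  have h1 : ENNReal.ofReal (∫ θ in Metric.closedBall u r, Real.exp (f ω θ) ∂vol) ≤ I ω := by
    rw [ofReal_integral_eq_lintegral_ofReal hei (ae_of_all _ fun _ => (Real.exp_pos _).le)]
    exact lintegral_mono_set hsub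
  refine le_trans ?_ h1
  have hbr : vol.real (Metric.closedBall u r)
      = r ^ Module.finrank ℝ V * vol.real (Metric.ball 0 1) := by
    rw [measureReal_def, Measure.addHaar_closedBall _ _ hr.le, ENNReal.toReal_mul,
      ENNReal.toReal_ofReal (by positivity), measureReal_def]
  have hBr : B = ENNReal.ofReal ((1 + r) ^ Module.finrank ℝ V * vol.real (Metric.ball 0 1)) := by
    rw [hB, Measure.addHaar_closedBall _ _ (by linarith), ENNReal.ofReal_mul (by positivity),
      measureReal_def, ENNReal.ofReal_toReal measure_ball_lt_top.ne]
  rw [hBr, ← ENNReal.ofReal_div_of_pos hδ]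
  refine ENNReal.ofReal_le_ofReal ?_
  have hbr0 : 0 < vol.real (Metric.closedBall u r) := ENNReal.toReal_pos hb0 hbt
  have h2 := (Real.exp_lt_exp.2 hlt).le.trans hJ
  rw [Real.exp_add, Real.exp_log (by positivity), mul_comm (Module.finrank ℝ V : ℝ), Real.exp_mul,
    Real.exp_log (by positivity), Real.rpow_natCast, setAverage_eq, smul_eq_mul,
    ← div_eq_inv_mul, le_div_iff₀ hbr0, hbr] at h2
  refine le_trans (le_of_eq ?_) h2
  rw [div_pow]
  field_simp

theorem setAverage_closedBall_eq_add {V : Type*} [NormedAddCommGroup V] [MeasurableSpace V]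
    [BorelSpace V] (vol : Measure V) [vol.IsAddLeftInvariant] (u : V) (r : ℝ) (f : V → ℝ) :
    ⨍ θ in Metric.closedBall u r, f θ ∂vol = ⨍ b in Metric.closedBall 0 r, f (u + b) ∂vol := by
  have hp : (fun b => u + b) ⁻¹' Metric.closedBall u r = Metric.closedBall 0 r := by
    ext b; simp
  have h1 := (measurePreserving_add_left vol u).setIntegral_preimage_emb
    (measurableEmbedding_addLeft u) f (Metric.closedBall u r)
  have h2 := measurePreserving_add_left vol u |>.measure_preimage_emb
    (measurableEmbedding_addLeft u) (Metric.closedBall u r)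
  rw [hp] at h1 h2
  rw [setAverage_eq, setAverage_eq, h1, measureReal_def, measureReal_def, h2]

/-- A linear map scales Haar measure by a constant, and an isometry fixes the unit ball, so the
constant is 1. No inner product is required, so this covers the sup norm on `V × W`. -/
theorem measurePreserving_linearIsometryEquiv {V : Type*} [NormedAddCommGroup V] [NormedSpace ℝ V]
    [FiniteDimensional ℝ V] [MeasurableSpace V] [BorelSpace V] (vol : Measure V)
    [vol.IsAddHaarMeasure] (R : V ≃ₗᵢ[ℝ] V) : MeasurePreserving R vol vol := by
  refine ⟨R.continuous.measurable, ?_⟩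
  have hdet : LinearMap.det (R.toLinearEquiv : V →ₗ[ℝ] V) ≠ 0 :=
    R.toLinearEquiv.isUnit_det'.ne_zero
  have hmap : vol.map R = ENNReal.ofReal |(LinearMap.det (R.toLinearEquiv : V →ₗ[ℝ] V))⁻¹| • vol :=
    Measure.map_linearMap_addHaar_eq_smul_addHaar vol hdet
  have hball := congrArg (fun ν => ν (Metric.closedBall (0 : V) 1)) hmap
  simp only [Measure.smul_apply, smul_eq_mul] at hball
  rw [Measure.map_apply R.continuous.measurable Metric.isClosed_closedBall.measurableSet,
    R.preimage_closedBall, map_zero] at hball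
  have hb0 : vol (Metric.closedBall (0 : V) 1) ≠ 0 :=
    (Metric.measure_closedBall_pos vol _ one_pos).ne'
  have hbt : vol (Metric.closedBall (0 : V) 1) ≠ ⊤ := measure_closedBall_lt_top.ne
  have h1 : ENNReal.ofReal |(LinearMap.det (R.toLinearEquiv : V →ₗ[ℝ] V))⁻¹| = 1 :=
    (ENNReal.mul_eq_right hb0 hbt).1 hball.symm
  rw [hmap, h1, one_smul]

theorem setAverage_closedBall_comp_isometry {V : Type*} [NormedAddCommGroup V] [NormedSpace ℝ V]
    [FiniteDimensional ℝ V] [MeasurableSpace V] [BorelSpace V] (vol : Measure V)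
    [vol.IsAddHaarMeasure] (R : V ≃ₗᵢ[ℝ] V) (r : ℝ) (f : V → ℝ) :
    ⨍ b in Metric.closedBall 0 r, f (R b) ∂vol = ⨍ b in Metric.closedBall 0 r, f b ∂vol := by
  have h := (measurePreserving_linearIsometryEquiv vol R).setIntegral_preimage_emb
    R.toHomeomorph.measurableEmbedding f (Metric.closedBall 0 r)
  rw [R.preimage_closedBall, map_zero] at h
  rw [setAverage_eq, setAverage_eq, h]

theorem setAverage_mono_of_continuous {V : Type*} [NormedAddCommGroup V] [NormedSpace ℝ V]
    [FiniteDimensional ℝ V] [MeasurableSpace V] [BorelSpace V] (vol : Measure V)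
    [vol.IsAddHaarMeasure] {u : V} {r : ℝ} {f g : V → ℝ} (hf : Continuous f) (hg : Continuous g)
    (h : ∀ b ∈ Metric.closedBall u r, f b ≤ g b) :
    ⨍ b in Metric.closedBall u r, f b ∂vol ≤ ⨍ b in Metric.closedBall u r, g b ∂vol := by
  have hc : IsCompact (Metric.closedBall u r) := isCompact_closedBall u r
  rw [setAverage_eq, setAverage_eq]
  exact smul_le_smul_of_nonneg_left (setIntegral_mono_on (hf.continuousOn.integrableOn_compact hc)
    (hg.continuousOn.integrableOn_compact hc) Metric.isClosed_closedBall.measurableSet h)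
    (by positivity)

theorem setAverage_const_closedBall {V : Type*} [NormedAddCommGroup V] [NormedSpace ℝ V]
    [FiniteDimensional ℝ V] [MeasurableSpace V] [BorelSpace V] (vol : Measure V)
    [vol.IsAddHaarMeasure] (u : V) {r : ℝ} (hr : 0 < r) (c : ℝ) :
    ⨍ _ in Metric.closedBall u r, c ∂vol = c :=
  setAverage_const (Metric.measure_closedBall_pos vol _ hr).ne' measure_closedBall_lt_top.ne c

theorem setAverage_add_of_continuous {V : Type*} [NormedAddCommGroup V] [NormedSpace ℝ V]
    [FiniteDimensional ℝ V] [MeasurableSpace V] [BorelSpace V] (vol : Measure V)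
    [vol.IsAddHaarMeasure] (u : V) (r : ℝ) {f g : V → ℝ} (hf : Continuous f) (hg : Continuous g) :
    ⨍ b in Metric.closedBall u r, (f b + g b) ∂vol
      = ⨍ b in Metric.closedBall u r, f b ∂vol + ⨍ b in Metric.closedBall u r, g b ∂vol := by
  have hc : IsCompact (Metric.closedBall u r) := isCompact_closedBall u r
  rw [setAverage_eq, setAverage_eq, setAverage_eq,
    integral_add (hf.continuousOn.integrableOn_compact hc) (hg.continuousOn.integrableOn_compact hc),
    smul_add]

theorem setAverage_const_mul {V : Type*} [MeasurableSpace V] (vol : Measure V) (s : Set V)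
    (c : ℝ) (f : V → ℝ) : ⨍ b in s, c * f b ∂vol = c * ⨍ b in s, f b ∂vol := by
  rw [setAverage_eq, setAverage_eq, integral_const_mul, smul_eq_mul, smul_eq_mul, mul_left_comm]

/-- The average of `f` over a ball about the origin is that of its symmetrization. -/
theorem setAverage_closedBall_symm {V : Type*} [NormedAddCommGroup V] [NormedSpace ℝ V]
    [FiniteDimensional ℝ V] [MeasurableSpace V] [BorelSpace V] (vol : Measure V)
    [vol.IsAddHaarMeasure] (R : V ≃ₗᵢ[ℝ] V) (r : ℝ) {f : V → ℝ} (hf : Continuous f) :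
    ⨍ b in Metric.closedBall 0 r, f b ∂vol
      = ⨍ b in Metric.closedBall 0 r, (1 / 2) * (f b + f (R b)) ∂vol := by
  rw [setAverage_const_mul, setAverage_add_of_continuous vol 0 r (g := fun b => f (R b)) hf
      (hf.comp R.continuous),
    setAverage_closedBall_comp_isometry]
  ring

/-- By rotation invariance the average is `‖g‖²` times a constant `A`; summing over an orthonormal
basis gives `n A`, the average of `‖b‖²`, at most `r²`. -/
theorem setAverage_inner_sq_le {n : ℕ} (i₀ : Fin n) {r : ℝ} (hr : 0 < r)
    (g : EuclideanSpace ℝ (Fin n)) :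
    ⨍ b in Metric.closedBall 0 r, (inner ℝ g b) ^ 2 ≤ r ^ 2 / n * ‖g‖ ^ 2 := by
  have hn : (0 : ℝ) < n := by exact_mod_cast Fin.pos i₀
  set A := ⨍ b in Metric.closedBall (0 : EuclideanSpace ℝ (Fin n)) r, (b i₀) ^ 2 with hA
  have key : ∀ g : EuclideanSpace ℝ (Fin n),
      ⨍ b in Metric.closedBall 0 r, (inner ℝ g b) ^ 2 = ‖g‖ ^ 2 * A := by
    intro g
    obtain ⟨R, hR⟩ := exists_linearIsometryEquiv_apply_eq
      (v := g) (w := EuclideanSpace.single i₀ ‖g‖) (by simp)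
    rw [hA, ← setAverage_closedBall_comp_isometry volume R r fun b => b i₀ ^ 2,
      ← setAverage_const_mul]
    congr 1
    ext b
    rw [← R.inner_map_map, hR, EuclideanSpace.inner_single_left]
    simp; ring
  have hsum : n * A ≤ r ^ 2 := by
    calc n * A = ∑ i : Fin n, ⨍ b in Metric.closedBall (0 : EuclideanSpace ℝ (Fin n)) r,
          (inner ℝ (EuclideanSpace.single i (1 : ℝ)) b) ^ 2 := by
            simp_rw [key]; simp
      _ = ⨍ b in Metric.closedBall (0 : EuclideanSpace ℝ (Fin n)) r, ‖b‖ ^ 2 := by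
            simp_rw [setAverage_eq, ← Finset.smul_sum]
            rw [← integral_finsetSum]
            · simp [EuclideanSpace.real_norm_sq_eq, EuclideanSpace.inner_single_left]
            · exact fun i _ => (Continuous.continuousOn (by fun_prop)).integrableOn_compact
                (isCompact_closedBall _ _)
      _ ≤ ⨍ b in Metric.closedBall (0 : EuclideanSpace ℝ (Fin n)) r, r ^ 2 :=
            setAverage_mono_of_continuous volume (by fun_prop) (by fun_prop) fun b hb => by
              have : ‖b‖ ≤ r := by simpa using hb
              gcongr
      _ = r ^ 2 := setAverage_const_closedBall _ _ hr _
  rw [key, div_mul_eq_mul_div, le_div_iff₀ hn]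
  nlinarith [mul_le_mul_of_nonneg_left hsum (sq_nonneg ‖g‖)]

/-! ### Weighted chi-square tails -/

theorem lintegral_exp_sum_pi {ι X : Type*} [Fintype ι] [MeasurableSpace X] (ν : Measure X)
    [IsProbabilityMeasure ν] {φ : ι → X → ℝ} (hφ : ∀ j, Measurable (φ j)) :
    ∫⁻ x, ENNReal.ofReal (Real.exp (∑ j, φ j (x j))) ∂(Measure.pi fun _ : ι => ν)
      = ∏ j, ∫⁻ x, ENNReal.ofReal (Real.exp (φ j x)) ∂ν := by
  rw [← lintegral_pi_prod (fun _ => ν) (fun j x => ENNReal.ofReal (Real.exp (φ j x)))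
    fun j => (hφ j).exp.ennreal_ofReal]
  refine lintegral_congr fun x => ?_
  rw [Real.exp_sum, ENNReal.ofReal_prod_of_nonneg fun i _ => (Real.exp_pos _).le]

/-- The square is linearised by an auxiliary Gaussian `z`: `exp (a‖S‖²)` is the mean of `exp ⟨√(2a)
z, S⟩`. After swapping integrals the `g j` integrate out independently, leaving the chi-square
transform of `z`. -/
theorem lintegral_exp_mul_norm_sq_sum_le {ι : Type*} [Fintype ι] {n : ℕ} (i₀ : Fin n) {a : ℝ}
    (ha0 : 0 ≤ a) (ha : a < 1 / 2) {c : ι → ℝ} (hc : ∑ j, c j ^ 2 ≤ 1) :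
    ∫⁻ g, ENNReal.ofReal (Real.exp (a * ‖∑ j, c j • g j‖ ^ 2))
        ∂(Measure.pi fun _ : ι => stdGaussian (EuclideanSpace ℝ (Fin n)))
      ≤ ENNReal.ofReal ((√(1 - 2 * a))⁻¹ ^ n) := by
  set Q := Measure.pi fun _ : ι => stdGaussian (EuclideanSpace ℝ (Fin n))
  have h1 : ∀ g : ι → EuclideanSpace ℝ (Fin n),
      ENNReal.ofReal (Real.exp (a * ‖∑ j, c j • g j‖ ^ 2))
      = ∫⁻ z, ENNReal.ofReal (Real.exp (∑ j, inner ℝ ((√(2 * a) * c j) • z) (g j)))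
          ∂(stdGaussian (EuclideanSpace ℝ (Fin n))) := by
    intro g
    have h := lintegral_exp_inner_stdGaussian (√(2 * a) • ∑ j, c j • g j)
    rw [norm_smul, Real.norm_of_nonneg (Real.sqrt_nonneg _), mul_pow,
      Real.sq_sqrt (by positivity)] at h
    rw [show a * ‖∑ j, c j • g j‖ ^ 2 = 2 * a * ‖∑ j, c j • g j‖ ^ 2 / 2 by ring, ← h]
    refine lintegral_congr fun z => ?_
    congr 2
    rw [Finset.smul_sum, sum_inner]
    refine Finset.sum_congr rfl fun j _ => ?_
    rw [smul_smul, real_inner_smul_left, real_inner_smul_left, real_inner_comm]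
  simp_rw [h1]
  rw [lintegral_lintegral_swap (by fun_prop)]
  have h2 : ∀ z : EuclideanSpace ℝ (Fin n),
      ∫⁻ g, ENNReal.ofReal (Real.exp (∑ j, inner ℝ ((√(2 * a) * c j) • z) (g j))) ∂Q
        ≤ ENNReal.ofReal (Real.exp (a * ‖z‖ ^ 2 - 0 * inner ℝ 0 z ^ 2)) := by
    intro z
    rw [lintegral_exp_sum_pi (φ := fun j g => inner ℝ ((√(2 * a) * c j) • z) g) _
      fun j => by fun_prop]
    simp_rw [lintegral_exp_inner_stdGaussian]
    rw [← ENNReal.ofReal_prod_of_nonneg fun i _ => (Real.exp_pos _).le, ← Real.exp_sum]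
    refine ENNReal.ofReal_le_ofReal (Real.exp_le_exp.2 ?_)
    have : ∀ j, ‖(√(2 * a) * c j) • z‖ ^ 2 / 2 = a * ‖z‖ ^ 2 * c j ^ 2 := by
      intro j
      rw [norm_smul, mul_pow, Real.norm_eq_abs, sq_abs, mul_pow, Real.sq_sqrt (by positivity)]
      ring
    simp_rw [this, ← Finset.mul_sum]
    nlinarith [mul_le_mul_of_nonneg_left hc (by positivity : 0 ≤ a * ‖z‖ ^ 2)]
  refine (lintegral_mono h2).trans (le_of_eq ?_)
  rw [lintegral_exp_quadratic_stdGaussian i₀ 0 ha (by simpa using ha)]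
  obtain ⟨k, rfl⟩ : ∃ k, n = k + 1 := ⟨n - 1, by have := Fin.pos i₀; omega⟩
  simp [pow_succ, mul_comm]

/-- Chi-square concentration for the Frobenius norm of a linear image of a Gaussian matrix. -/
theorem measure_sum_norm_sq_gt_le {ι α : Type*} [Fintype ι] [Fintype α] {n : ℕ} (hn : 0 < n)
    (M : ι → α → ℝ) {s : ℝ} (hs : 0 < s) :
    Measure.pi (fun _ : ι => stdGaussian (EuclideanSpace ℝ (Fin n)))
      {g | (√n + s) ^ 2 * ∑ a, ∑ j, M j a ^ 2 < ∑ a, ‖∑ j, M j a • g j‖ ^ 2}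
      ≤ ENNReal.ofReal (Real.exp (-s ^ 2 / 2)) := by
  set Q := Measure.pi fun _ : ι => stdGaussian (EuclideanSpace ℝ (Fin n))
  set w : α → ℝ := fun a => ∑ j, M j a ^ 2 with hw
  have hw0 : ∀ a, 0 ≤ w a := fun a => Finset.sum_nonneg fun j _ => sq_nonneg _
  set S := ∑ a, w a with hS
  have hS0 : 0 ≤ S := Finset.sum_nonneg fun a _ => hw0 a
  -- Normalised coefficients. They vanish when `w a = 0`, so their squares sum to at most 1, not
  -- exactly 1.
  set c : α → ι → ℝ := fun a j => M j a / √(w a) with hc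
  have hcM : ∀ a j, M j a = √(w a) * c a j := by
    intro a j
    rcases (hw0 a).eq_or_lt with h | h
    · have := (Finset.sum_eq_zero_iff_of_nonneg fun j _ => sq_nonneg (M j a)).1 h.symm j
        (Finset.mem_univ j)
      simp only [hc, ← h, Real.sqrt_zero, zero_mul]
      exact pow_eq_zero_iff two_ne_zero |>.1 this
    · simp only [hc]
      rw [mul_div_cancel₀ _ (Real.sqrt_pos.2 h).ne']
  have hc1 : ∀ a, ∑ j, c a j ^ 2 ≤ 1 := by
    intro a
    simp only [hc, div_pow, Real.sq_sqrt (hw0 a), ← Finset.sum_div]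
    exact div_self_le_one _
  set V : α → (ι → EuclideanSpace ℝ (Fin n)) → ℝ := fun a g => ‖∑ j, c a j • g j‖ ^ 2 with hV
  have hF : ∀ g : ι → EuclideanSpace ℝ (Fin n),
      ∑ a, ‖∑ j, M j a • g j‖ ^ 2 = ∑ a, w a * V a g := by
    intro g
    refine Finset.sum_congr rfl fun a _ => ?_
    simp_rw [hcM a, mul_smul, ← Finset.smul_sum]
    rw [norm_smul, Real.norm_of_nonneg (Real.sqrt_nonneg _), mul_pow, Real.sq_sqrt (hw0 a)]
  simp_rw [hF]
  rcases hS0.eq_or_lt with h | hSpos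
  · have hwz : ∀ a, w a = 0 := fun a =>
      (Finset.sum_eq_zero_iff_of_nonneg fun a _ => hw0 a).1 h.symm a (Finset.mem_univ a)
    simp [← h, hwz]
  have hn' : (0 : ℝ) < n := by exact_mod_cast hn
  have hsn : 0 < √(n : ℝ) := Real.sqrt_pos.2 hn'
  set T : ℝ := (√n + s) ^ 2 with hT
  have hTn : (n : ℝ) < T := by
    rw [hT]; nlinarith [Real.sq_sqrt hn'.le, mul_pos hsn hs]
  have hT0 : 0 < T := hn'.trans hTn
  -- The minimiser of the Chernoff bound `(1 - 2a)^(-n/2) exp (-aT)`.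
  set a : ℝ := (1 - n / T) / 2 with ha
  have hq : n / T < 1 := (div_lt_one hT0).2 hTn
  have hq0 : 0 < n / T := by positivity
  -- The variables `V b` are dependent; since the exponent is a convex combination of them,
  -- convexity of `exp` reduces to each one separately.
  have hint : ∫⁻ g, ENNReal.ofReal (Real.exp (a * ((∑ b, w b * V b g) / S))) ∂Q
      ≤ ENNReal.ofReal ((√(1 - 2 * a))⁻¹ ^ n) := by
    calc ∫⁻ g, ENNReal.ofReal (Real.exp (a * ((∑ b, w b * V b g) / S))) ∂Q
        ≤ ∫⁻ g, ∑ b, ENNReal.ofReal (w b / S) * ENNReal.ofReal (Real.exp (a * V b g)) ∂Q := by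
          refine lintegral_mono fun g => ?_
          simp_rw [← ENNReal.ofReal_mul (div_nonneg (hw0 _) hS0)]
          rw [← ENNReal.ofReal_sum_of_nonneg fun b _ =>
            mul_nonneg (div_nonneg (hw0 b) hS0) (Real.exp_pos _).le]
          refine ENNReal.ofReal_le_ofReal ?_
          have := convexOn_exp.map_sum_le (t := Finset.univ) (w := fun b => w b / S)
            (p := fun b => a * V b g) (fun b _ => div_nonneg (hw0 b) hS0)
            (by rw [← Finset.sum_div]; exact div_self hSpos.ne') (by simp)
          simp only [smul_eq_mul] at this
          refine le_trans (le_of_eq ?_) this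
          congr 1
          rw [Finset.sum_div, Finset.mul_sum]
          exact Finset.sum_congr rfl fun b _ => by ring
      _ = ∑ b, ENNReal.ofReal (w b / S) * ∫⁻ g, ENNReal.ofReal (Real.exp (a * V b g)) ∂Q := by
          rw [lintegral_finsetSum _ fun b _ => by simp only [hV]; fun_prop]
          refine Finset.sum_congr rfl fun b _ => lintegral_const_mul _ ?_
          simp only [hV]; fun_prop
      _ ≤ ∑ b, ENNReal.ofReal (w b / S) * ENNReal.ofReal ((√(1 - 2 * a))⁻¹ ^ n) := by
          gcongr with b
          exact lintegral_exp_mul_norm_sq_sum_le ⟨0, hn⟩ (by linarith) (by linarith) (hc1 b)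
      _ = _ := by
          rw [← Finset.sum_mul, ← ENNReal.ofReal_sum_of_nonneg fun b _ => div_nonneg (hw0 b) hS0,
            ← Finset.sum_div, div_self hSpos.ne', ENNReal.ofReal_one, one_mul]
  have hsub : {g | T * S < ∑ b, w b * V b g} ⊆ {g | ENNReal.ofReal (Real.exp (a * T))
      ≤ ENNReal.ofReal (Real.exp (a * ((∑ b, w b * V b g) / S)))} := by
    intro g hg
    refine ENNReal.ofReal_le_ofReal (Real.exp_le_exp.2 ?_)
    exact mul_le_mul_of_nonneg_left ((le_div_iff₀ hSpos).2 (le_of_lt hg)) (by linarith)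
  refine (measure_mono hsub).trans ((meas_ge_le_lintegral_div
    (Measurable.aemeasurable (by simp only [hV]; fun_prop)) (by simp [Real.exp_pos])
    ENNReal.ofReal_ne_top).trans ?_)
  refine (ENNReal.div_le_div_right hint _).trans ?_
  rw [← ENNReal.ofReal_div_of_pos (Real.exp_pos _)]
  refine ENNReal.ofReal_le_ofReal ?_
  have h1 : (√(1 - 2 * a))⁻¹ = 1 + s / √n := by
    rw [ha, show 1 - 2 * ((1 - n / T) / 2) = n / T by ring, Real.sqrt_div hn'.le, hT,
      Real.sqrt_sq (by positivity)]
    field_simp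
  have h2 : (1 + s / √n) ^ n ≤ Real.exp (s * √n) := by
    calc (1 + s / √n) ^ n ≤ Real.exp (s / √n) ^ n := by
          gcongr
          linarith [Real.add_one_le_exp (s / √n)]
      _ = Real.exp (s * √n) := by
          rw [← Real.exp_nat_mul]
          congr 1
          field_simp
          rw [Real.sq_sqrt hn'.le]
  rw [h1, div_le_iff₀ (Real.exp_pos _), ← Real.exp_add]
  refine h2.trans (Real.exp_le_exp.2 (le_of_eq ?_))
  have h3 : a * T = (T - n) / 2 := by rw [ha]; field_simp
  rw [h3, hT]
  nlinarith [Real.sq_sqrt hn'.le]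

/-! ### Least singular value of a Gaussian matrix -/

theorem one_sub_inv_pow_ge {n : ℕ} (hn : 0 < n) :
    (7 / 8 : ℝ) ≤ (1 - 2 * (1 / (16 * (n : ℝ)))) ^ n := by
  have hn' : (1 : ℝ) ≤ n := by exact_mod_cast hn
  have h1 : 1 / (16 * (n : ℝ)) ≤ 1 / 16 :=
    one_div_le_one_div_of_le (by norm_num) (by linarith)
  have h := one_add_mul_le_pow (a := -(2 * (1 / (16 * (n : ℝ))))) (by linarith) n
  rw [← sub_eq_add_neg] at h
  refine le_trans (le_of_eq ?_) h
  field_simp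
  norm_num

/-- The numerical inequality closing the singular value bound, after multiplication by `t / 8`: `2`
comes from the threshold `t / 4`, `log 5` from the entropy with `r = 1/4`. -/
theorem two_add_log_five_le :
    2 + Real.log 5 ≤ 2 * Real.log (561 / 64) + 4 * Real.log (7 / 8) := by
  have h2 : (2 : ℝ) = Real.log (Real.exp 2) := (Real.log_exp 2).symm
  have he : Real.exp 2 < 7.39 := by
    rw [show (2 : ℝ) = 1 + 1 by norm_num, Real.exp_add]
    nlinarith [Real.exp_one_lt_d9, Real.exp_pos 1]
  have h : 2 * Real.log (561 / 64) + 4 * Real.log (7 / 8)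
      = Real.log ((561 / 64) ^ 2 * (7 / 8) ^ 4) := by
    rw [Real.log_mul (by norm_num) (by norm_num), Real.log_pow, Real.log_pow]; norm_num
  rw [h]
  nth_rw 1 [h2]
  rw [← Real.log_mul (Real.exp_pos 2).ne' (by norm_num)]
  refine Real.log_le_log (by positivity) ?_
  norm_num at he ⊢
  linarith

/-- With `β = ‖b‖²`, the product of the two arguments is `(3 + 2β)² - 16⟨u,b⟩² ≥ 9 - 4β + 4β²`. The
worst case is `b` parallel to `u` with `β = 1/16`, giving `561/64`. -/
theorem log_add_log_one_add_norm_sq_ge {E : Type*} [NormedAddCommGroup E] [InnerProductSpace ℝ E]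
    {u b : E} (hu : ‖u‖ = 1) (hb : ‖b‖ ≤ 1 / 4) :
    Real.log (561 / 64) ≤ Real.log (1 + 2 * ‖u + b‖ ^ 2) + Real.log (1 + 2 * ‖u - b‖ ^ 2) := by
  rw [← Real.log_mul (by positivity) (by positivity)]
  refine Real.log_le_log (by norm_num) ?_
  rw [norm_add_sq_real, norm_sub_sq_real, hu]
  have h1 : (inner ℝ u b) ^ 2 ≤ ‖b‖ ^ 2 := by
    have := abs_real_inner_le_norm u b
    rw [hu, one_mul] at this
    exact sq_le_sq' (by linarith [neg_abs_le (inner ℝ u b)])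
      (by linarith [le_abs_self (inner ℝ u b)])
  have h2 : ‖b‖ ^ 2 ≤ 1 / 16 := by nlinarith [norm_nonneg b]
  nlinarith [sq_nonneg ‖b‖]

/-- Lower bound for the least singular value of a Gaussian matrix. -/
theorem measure_exists_sum_inner_sq_lt_le {ι : Type*} [Fintype ι] {n : ℕ} (hn : 0 < n) {δ : ℝ}
    (hδ : 0 < δ) (hδ1 : δ ≤ 1)
    (ht : 8 * (n : ℝ) + 16 * Real.log (2 / δ) ≤ (Fintype.card ι : ℝ)) :
    Measure.pi (fun _ : ι => stdGaussian (EuclideanSpace ℝ (Fin n)))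
      {g | ∃ u : EuclideanSpace ℝ (Fin n), ‖u‖ = 1 ∧
        ∑ j, (inner ℝ (g j) u) ^ 2 < (Fintype.card ι : ℝ) / 4}
      ≤ ENNReal.ofReal δ := by
  have hn' : (1 : ℝ) ≤ n := by exact_mod_cast hn
  set t : ℝ := (Fintype.card ι : ℝ) with ht'
  -- This is `r² / n` for `r = 1/4`: `κ‖g‖²` then dominates the average of `⟨g,b⟩²` over the small
  -- ball.
  set κ : ℝ := 1 / (16 * (n : ℝ)) with hκ
  have hκ0 : 0 ≤ κ := by positivity
  have hκ1 : κ ≤ 1 / 16 := one_div_le_one_div_of_le (by norm_num) (by linarith)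
  have hk : 0 < 1 - 2 * κ := by linarith
  -- `X / 2` compensates the log moment generating function; mean at most 1 follows from `(1 +
  -- 2‖θ‖²)(1 - 2κ) ≤ 1 - 2κ + 2‖θ‖²`.
  set X : EuclideanSpace ℝ (Fin n) → ℝ := fun θ =>
    Real.log (1 + 2 * ‖θ‖ ^ 2) + n * Real.log (1 - 2 * κ) with hX
  have hXc : Continuous X := by
    have : Continuous fun θ : EuclideanSpace ℝ (Fin n) => Real.log (1 + 2 * ‖θ‖ ^ 2) :=
      Continuous.log (by fun_prop) fun θ => by positivity
    exact this.add continuous_const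
  set f : (ι → EuclideanSpace ℝ (Fin n)) → EuclideanSpace ℝ (Fin n) → ℝ := fun g θ =>
    ∑ j, ((κ * ‖g j‖ ^ 2 - 1 * (inner ℝ θ (g j)) ^ 2) + 1 / 2 * X θ) with hf
  have hfc2 : Continuous (Function.uncurry f) := by
    simp only [hf, Function.uncurry_def]
    fun_prop
  have hfc : ∀ g, Continuous (f g) := fun g => by
    simp only [hf]
    fun_prop
  have hexp : ∀ θ, ‖θ‖ ≤ 1 + 1 / 4 → ∫⁻ g, ENNReal.ofReal (Real.exp (f g θ))
      ∂(Measure.pi fun _ : ι => stdGaussian (EuclideanSpace ℝ (Fin n))) ≤ 1 := by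
    intro θ _
    rw [lintegral_exp_sum_pi (φ := fun _ g => κ * ‖g‖ ^ 2 - 1 * (inner ℝ θ g) ^ 2 + 1 / 2 * X θ) _
      fun _ => by fun_prop]
    refine Finset.prod_le_one' fun j _ => ?_
    simp_rw [Real.exp_add, ENNReal.ofReal_mul (Real.exp_pos _).le]
    rw [lintegral_mul_const _ (by fun_prop),
      lintegral_exp_quadratic_stdGaussian ⟨0, hn⟩ θ (by linarith) (by nlinarith [sq_nonneg ‖θ‖]),
      ← ENNReal.ofReal_mul (by positivity), ← ENNReal.ofReal_one]
    refine ENNReal.ofReal_le_ofReal ?_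
    have hq : 0 ≤ ‖θ‖ ^ 2 := sq_nonneg _
    have hA : 0 < 1 - 2 * (κ - 1 * ‖θ‖ ^ 2) := by linarith
    have hXe : Real.exp (1 / 2 * X θ) = √(1 + 2 * ‖θ‖ ^ 2) * √(1 - 2 * κ) ^ n := by
      rw [hX, mul_add, Real.exp_add, Real.sqrt_eq_rpow, Real.sqrt_eq_rpow,
        Real.rpow_def_of_pos (by positivity), Real.rpow_def_of_pos hk, ← Real.exp_nat_mul]
      congr 2 <;> ring
    rw [hXe]
    obtain ⟨k, rfl⟩ : ∃ k, n = k + 1 := ⟨n - 1, by omega⟩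
    have hs : √(1 - 2 * κ) ≠ 0 := (Real.sqrt_pos.2 hk).ne'
    rw [Nat.add_sub_cancel, pow_succ (√(1 - 2 * κ)), inv_pow]
    have : (√(1 - 2 * (κ - 1 * ‖θ‖ ^ 2)))⁻¹ * (√(1 - 2 * κ) ^ k)⁻¹ *
        (√(1 + 2 * ‖θ‖ ^ 2) * (√(1 - 2 * κ) ^ k * √(1 - 2 * κ)))
        = (√(1 + 2 * ‖θ‖ ^ 2) * √(1 - 2 * κ)) / √(1 - 2 * (κ - 1 * ‖θ‖ ^ 2)) := by
      field_simp
    rw [this, div_le_one (Real.sqrt_pos.2 hA), ← Real.sqrt_mul (by positivity)]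
    refine Real.sqrt_le_sqrt ?_
    nlinarith [mul_nonneg hκ0 hq]
  refine (measure_mono ?_).trans (measure_exists_setAverage_gt_le
    (Measure.pi fun _ : ι => stdGaussian (EuclideanSpace ℝ (Fin n))) volume (r := 1 / 4)
    (by norm_num) hδ f hfc2.measurable hfc hexp)
  rintro g ⟨u, hu, hlt⟩
  refine ⟨u, hu.le, ?_⟩
  set W : ℝ := ∑ j, ‖g j‖ ^ 2 with hW
  -- Pairing `b` with `-b` removes the cross terms of the quadratic form and lets the two logarithms
  -- be bounded jointly.
  have hsymm : ∀ b ∈ Metric.closedBall (0 : EuclideanSpace ℝ (Fin n)) (1 / 4),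
      (κ * W - ∑ j, (inner ℝ (g j) u) ^ 2
        + t / 2 * (1 / 2 * Real.log (561 / 64) + n * Real.log (1 - 2 * κ)))
        + (-1) * ∑ j, (inner ℝ (g j) b) ^ 2
      ≤ 1 / 2 * (f g (u + b) + f g (u + LinearIsometryEquiv.neg ℝ b)) := by
    intro b hb
    have hlog := log_add_log_one_add_norm_sq_ge hu (b := b) (by simpa using hb)
    have ht0 : 0 ≤ t := by positivity
    have h1 : ∀ θ, f g θ = κ * W - ∑ j, (inner ℝ (g j) θ) ^ 2 + t / 2 * X θ := by
      intro θ
      simp only [hf, Finset.sum_add_distrib, Finset.sum_sub_distrib, ← Finset.mul_sum, hW, one_mul,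
        Finset.sum_const, Finset.card_univ, nsmul_eq_mul, ← ht']
      simp_rw [real_inner_comm]
      ring
    have h2 : ∑ j, (inner ℝ (g j) (u + b)) ^ 2 + ∑ j, (inner ℝ (g j) (u - b)) ^ 2
        = 2 * ∑ j, (inner ℝ (g j) u) ^ 2 + 2 * ∑ j, (inner ℝ (g j) b) ^ 2 := by
      rw [Finset.mul_sum, Finset.mul_sum, ← Finset.sum_add_distrib, ← Finset.sum_add_distrib]
      refine Finset.sum_congr rfl fun j _ => ?_
      rw [inner_add_right, inner_sub_right]; ring
    rw [LinearIsometryEquiv.coe_neg, ← sub_eq_add_neg, h1, h1]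
    simp only [hX]
    nlinarith [mul_le_mul_of_nonneg_left hlog ht0]
  have hiso : ⨍ b in Metric.closedBall (0 : EuclideanSpace ℝ (Fin n)) (1 / 4),
      ∑ j, (inner ℝ (g j) b) ^ 2 ≤ κ * W := by
    have : ⨍ b in Metric.closedBall (0 : EuclideanSpace ℝ (Fin n)) (1 / 4),
        ∑ j, (inner ℝ (g j) b) ^ 2
        = ∑ j, ⨍ b in Metric.closedBall (0 : EuclideanSpace ℝ (Fin n)) (1 / 4),
          (inner ℝ (g j) b) ^ 2 := by
      simp_rw [setAverage_eq, ← Finset.smul_sum]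
      rw [← integral_finsetSum]
      exact fun i _ => (Continuous.continuousOn (by fun_prop)).integrableOn_compact
        (isCompact_closedBall _ _)
    rw [this, hW, Finset.mul_sum]
    refine Finset.sum_le_sum fun j _ =>
      (setAverage_inner_sq_le ⟨0, hn⟩ (by norm_num) (g j)).trans (le_of_eq ?_)
    rw [hκ]; field_simp; ring
  have havg := setAverage_mono_of_continuous (volume : Measure (EuclideanSpace ℝ (Fin n)))
    (u := 0) (r := 1 / 4) (by fun_prop) (by fun_prop) hsymm
  rw [← setAverage_closedBall_symm volume (LinearIsometryEquiv.neg ℝ) (1 / 4)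
      (f := fun b => f g (u + b)) (by fun_prop), ← setAverage_closedBall_eq_add,
    setAverage_add_of_continuous _ _ _ (by fun_prop) (by fun_prop),
    setAverage_const_closedBall _ _ (by norm_num), setAverage_const_mul] at havg
  have hlogk : Real.log (7 / 8) ≤ n * Real.log (1 - 2 * κ) := by
    rw [← Real.log_pow]
    exact Real.log_le_log (by norm_num) (one_sub_inv_pow_ge hn)
  have hlogδ : 0 ≤ Real.log (1 / δ) := Real.log_nonneg (by rw [le_div_iff₀ hδ]; linarith)
  have hlog2 : Real.log (1 / δ) ≤ Real.log (2 / δ) :=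
    Real.log_le_log (by positivity) (by gcongr; norm_num)
  have hlog5 : 1 ≤ Real.log 5 := by
    rw [Real.le_log_iff_exp_le (by norm_num)]
    linarith [Real.exp_one_lt_d9]
  have ht0 : 0 ≤ t := by positivity
  have h5 : Real.log ((1 + 1 / 4) / (1 / 4)) = Real.log 5 := by norm_num
  rw [finrank_euclideanSpace_fin, h5]
  have key : n * Real.log 5 + Real.log (1 / δ) ≤ t / 8 * Real.log 5 := by
    nlinarith [mul_le_mul_of_nonneg_right ht (by linarith : 0 ≤ Real.log 5),
      mul_nonneg (hlogδ.trans hlog2) (by linarith : 0 ≤ Real.log 5 - 1)]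
  have hnum := two_add_log_five_le
  nlinarith [mul_le_mul_of_nonneg_left hlogk ht0, mul_le_mul_of_nonneg_left hnum ht0]

/-! ### Product of two independent Gaussian matrices -/

/-- The isometry `(a, b) ↦ (-a, b)`. -/
noncomputable def negFst (V W : Type*) [NormedAddCommGroup V] [NormedSpace ℝ V]
    [NormedAddCommGroup W] [NormedSpace ℝ W] : (V × W) ≃ₗᵢ[ℝ] (V × W) where
  toLinearEquiv := LinearEquiv.prodCongr (LinearEquiv.neg ℝ) (LinearEquiv.refl ℝ W)
  norm_map' x := by simp [Prod.norm_def]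

theorem negFst_apply {V W : Type*} [NormedAddCommGroup V] [NormedSpace ℝ V]
    [NormedAddCommGroup W] [NormedSpace ℝ W] (b : V × W) : negFst V W b = (-b.1, b.2) := rfl

/-- Balls about 0 in `V × W` are invariant under sign change of the first factor, which kills the
terms involving `b.1`; the full sign change kills the remaining linear term in `b.2`. -/
theorem setAverage_closedBall_bilinear {V W : Type*} [NormedAddCommGroup V] [NormedSpace ℝ V]
    [FiniteDimensional ℝ V] [MeasurableSpace V] [BorelSpace V] [NormedAddCommGroup W]
    [NormedSpace ℝ W] [FiniteDimensional ℝ W] [MeasurableSpace W] [BorelSpace W]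
    (vol : Measure (V × W)) [vol.IsAddHaarMeasure] (F : V →ₗ[ℝ] W →ₗ[ℝ] ℝ)
    (hF : Continuous fun b : V × W => F b.1 b.2) (u : V × W) {r : ℝ} (hr : 0 < r) :
    ⨍ b in Metric.closedBall u r, F b.1 b.2 ∂vol = F u.1 u.2 := by
  have hc : ∀ v : V, Continuous fun b : V × W => F v (u.2 + b.2) := fun v =>
    hF.comp (by fun_prop : Continuous fun b : V × W => (v, u.2 + b.2))
  rw [setAverage_closedBall_eq_add, setAverage_closedBall_symm vol (negFst V W) r
    (f := fun b => F (u + b).1 (u + b).2) (hF.comp (by fun_prop : Continuous fun b : V × W => u + b))]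
  have h1 : ∀ b : V × W, 1 / 2 * (F (u + b).1 (u + b).2
      + F (u + negFst V W b).1 (u + negFst V W b).2) = F u.1 (u.2 + b.2) := by
    intro b
    simp only [negFst_apply, Prod.fst_add, Prod.snd_add, map_add, map_neg, LinearMap.add_apply,
      LinearMap.neg_apply]
    ring
  simp only [h1]
  rw [setAverage_closedBall_symm vol (LinearIsometryEquiv.neg ℝ) r (hc u.1)]
  have h2 : ∀ b : V × W, 1 / 2 * (F u.1 (u.2 + b.2)
      + F u.1 (u.2 + ((LinearIsometryEquiv.neg ℝ : (V × W) ≃ₗᵢ[ℝ] (V × W)) b).2))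
      = F u.1 u.2 := by
    intro b
    simp only [LinearIsometryEquiv.coe_neg, Prod.snd_neg, map_add, map_neg]
    ring
  simp only [h2]
  exact setAverage_const_closedBall vol 0 hr _

/-- Integrating the second Gaussian first leaves the exponential of a multiple of `⟨φ,g⟩²`, a case
of the quadratic formula with `κ = 0`. -/
theorem lintegral_exp_inner_mul_inner_stdGaussian {n l : ℕ} (i₀ : Fin n) (lam : ℝ)
    (θ : EuclideanSpace ℝ (Fin l)) (φ : EuclideanSpace ℝ (Fin n))
    (h : lam ^ 2 * ‖θ‖ ^ 2 * ‖φ‖ ^ 2 < 1) :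
    ∫⁻ w, ENNReal.ofReal (Real.exp (lam * (inner ℝ θ w.2 * inner ℝ φ w.1)))
      ∂((stdGaussian (EuclideanSpace ℝ (Fin n))).prod (stdGaussian (EuclideanSpace ℝ (Fin l))))
      = ENNReal.ofReal (√(1 - lam ^ 2 * ‖θ‖ ^ 2 * ‖φ‖ ^ 2))⁻¹ := by
  rw [lintegral_prod _ (Measurable.aemeasurable (by fun_prop))]
  have h1 : ∀ g : EuclideanSpace ℝ (Fin n), ∫⁻ z, ENNReal.ofReal (Real.exp
      (lam * (inner ℝ θ z * inner ℝ φ g))) ∂(stdGaussian (EuclideanSpace ℝ (Fin l)))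
      = ENNReal.ofReal (Real.exp
        (0 * ‖g‖ ^ 2 - (-(lam ^ 2 * ‖θ‖ ^ 2 / 2)) * (inner ℝ φ g) ^ 2)) := by
    intro g
    have := lintegral_exp_inner_stdGaussian ((lam * inner ℝ φ g) • θ)
    rw [norm_smul, mul_pow, Real.norm_eq_abs, sq_abs] at this
    rw [show 0 * ‖g‖ ^ 2 - (-(lam ^ 2 * ‖θ‖ ^ 2 / 2)) * (inner ℝ φ g) ^ 2
      = (lam * inner ℝ φ g) ^ 2 * ‖θ‖ ^ 2 / 2 by ring, ← this]
    refine lintegral_congr fun z => ?_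
    rw [real_inner_smul_left, mul_assoc, mul_comm (inner ℝ φ g)]
  simp only [h1]
  rw [lintegral_exp_quadratic_stdGaussian i₀ φ (by norm_num) (by linarith)]
  rw [show 1 - 2 * (0 - -(lam ^ 2 * ‖θ‖ ^ 2 / 2) * ‖φ‖ ^ 2)
    = 1 - lam ^ 2 * ‖θ‖ ^ 2 * ‖φ‖ ^ 2 by ring]
  simp

theorem neg_two_mul_le_log_one_sub {x : ℝ} (h0 : 0 ≤ x) (h1 : x ≤ 1 / 2) :
    -(2 * x) ≤ Real.log (1 - x) := by
  have h := Real.one_sub_inv_le_log_of_pos (by linarith : 0 < 1 - x)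
  refine le_trans ?_ h
  rw [← sub_nonneg]
  have : 1 - (1 - x)⁻¹ - -(2 * x) = x * (1 - 2 * x) / (1 - x) := by
    have : 1 - x ≠ 0 := by linarith
    field_simp; ring
  rw [this]
  exact div_nonneg (mul_nonneg h0 (by linarith)) (by linarith)

theorem exists_bilinear_eq_sum_inner_mul_inner {ι V W : Type*} [Fintype ι] [NormedAddCommGroup V]
    [InnerProductSpace ℝ V] [NormedAddCommGroup W] [InnerProductSpace ℝ W] (w : ι → V × W) :
    ∃ F : W →ₗ[ℝ] V →ₗ[ℝ] ℝ,
      ∀ θ φ, F θ φ = ∑ j, inner ℝ θ (w j).2 * inner ℝ φ (w j).1 :=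
  ⟨LinearMap.mk₂ ℝ (fun θ φ => ∑ j, inner ℝ θ (w j).2 * inner ℝ φ (w j).1)
      (fun a b d => by simp [inner_add_left, add_mul, Finset.sum_add_distrib])
      (fun a b d => by simp [real_inner_smul_left, Finset.mul_sum, mul_assoc])
      (fun a b d => by simp [inner_add_left, mul_add, Finset.sum_add_distrib])
      (fun a b d => by simp [real_inner_smul_left, Finset.mul_sum, mul_left_comm]),
    fun _ _ => rfl⟩

/-- PAC-Bayes on the product space with `r = 1/2`: the volume ratio is `3 ^ (l + n)`, the enlarged
ball has radius `3/2`, whence `81/16 = (9/4)²`, and averaging a bilinear form costs nothing. -/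
theorem measure_exists_sum_inner_mul_inner_gt_le {ι : Type*} [Fintype ι] {n l : ℕ} (hn : 0 < n)
    {lam δ : ℝ} (hδ : 0 < δ) (hlam : lam ^ 2 * (81 / 16) < 1) :
    Measure.pi (fun _ : ι => (stdGaussian (EuclideanSpace ℝ (Fin n))).prod
        (stdGaussian (EuclideanSpace ℝ (Fin l))))
      {w | ∃ (u : EuclideanSpace ℝ (Fin l)) (v : EuclideanSpace ℝ (Fin n)), ‖u‖ ≤ 1 ∧ ‖v‖ ≤ 1 ∧
        (l + n : ℕ) * Real.log 3 + Real.log (1 / δ) <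
          lam * (∑ j, inner ℝ u (w j).2 * inner ℝ v (w j).1)
            + (Fintype.card ι : ℝ) / 2 * Real.log (1 - lam ^ 2 * (81 / 16))}
      ≤ ENNReal.ofReal δ := by
  set Q := Measure.pi (fun _ : ι => (stdGaussian (EuclideanSpace ℝ (Fin n))).prod
        (stdGaussian (EuclideanSpace ℝ (Fin l))))
  set c : ℝ := Real.log (1 - lam ^ 2 * (81 / 16)) with hc
  set f : (ι → EuclideanSpace ℝ (Fin n) × EuclideanSpace ℝ (Fin l)) →
      (EuclideanSpace ℝ (Fin l) × EuclideanSpace ℝ (Fin n)) → ℝ := fun w b =>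
    ∑ j, (lam * (inner ℝ b.1 (w j).2 * inner ℝ b.2 (w j).1) + 1 / 2 * c) with hf
  have hfc2 : Continuous (Function.uncurry f) := by
    simp only [hf, Function.uncurry_def]
    fun_prop
  have hfc : ∀ g, Continuous (f g) := fun g => by
    simp only [hf]
    fun_prop
  have hexp : ∀ b, ‖b‖ ≤ 1 + 1 / 2 → ∫⁻ w, ENNReal.ofReal (Real.exp (f w b)) ∂Q ≤ 1 := by
    intro b hb
    have hb1 : ‖b.1‖ ^ 2 ≤ 9 / 4 := by nlinarith [norm_fst_le b, norm_nonneg b.1]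
    have hb2 : ‖b.2‖ ^ 2 ≤ 9 / 4 := by nlinarith [norm_snd_le b, norm_nonneg b.2]
    have hb12 : lam ^ 2 * ‖b.1‖ ^ 2 * ‖b.2‖ ^ 2 ≤ lam ^ 2 * (81 / 16) := by
      rw [mul_assoc]
      refine mul_le_mul_of_nonneg_left ?_ (sq_nonneg _)
      nlinarith [sq_nonneg ‖b.1‖, sq_nonneg ‖b.2‖]
    rw [lintegral_exp_sum_pi (φ := fun _ (w : EuclideanSpace ℝ (Fin n) × EuclideanSpace ℝ (Fin l)) =>
        lam * (inner ℝ b.1 w.2 * inner ℝ b.2 w.1) + 1 / 2 * c) _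
      fun _ => by fun_prop]
    refine Finset.prod_le_one' fun j _ => ?_
    simp_rw [Real.exp_add, ENNReal.ofReal_mul (Real.exp_pos _).le]
    rw [lintegral_mul_const _ (by fun_prop),
      lintegral_exp_inner_mul_inner_stdGaussian ⟨0, hn⟩ _ _ _ (hb12.trans_lt hlam),
      ← ENNReal.ofReal_mul (by positivity), ← ENNReal.ofReal_one]
    refine ENNReal.ofReal_le_ofReal ?_
    have hce : Real.exp (1 / 2 * c) = √(1 - lam ^ 2 * (81 / 16)) := by
      rw [Real.sqrt_eq_rpow, Real.rpow_def_of_pos (by linarith), mul_comm]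
    rw [hce, inv_mul_le_one₀ (Real.sqrt_pos.2 (by linarith))]
    exact Real.sqrt_le_sqrt (by linarith)
  have hvol : ((volume : Measure (EuclideanSpace ℝ (Fin l))).prod
      (volume : Measure (EuclideanSpace ℝ (Fin n)))).IsAddHaarMeasure := inferInstance
  refine (measure_mono ?_).trans (measure_exists_setAverage_gt_le Q
    ((volume : Measure (EuclideanSpace ℝ (Fin l))).prod
      (volume : Measure (EuclideanSpace ℝ (Fin n)))) (r := 1 / 2)
    (by norm_num) hδ f hfc2.measurable hfc hexp)
  rintro w ⟨u, v, hu, hv, hlt⟩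
  refine ⟨(u, v), max_le hu hv, ?_⟩
  obtain ⟨F, hF⟩ := exists_bilinear_eq_sum_inner_mul_inner w
  have hfF : ∀ b, f w b = lam * F b.1 b.2 + (Fintype.card ι : ℝ) / 2 * c := by
    intro b
    simp only [hf, hF, Finset.sum_add_distrib, Finset.mul_sum,
      Finset.sum_const, Finset.card_univ, nsmul_eq_mul]
    ring
  have hFc : Continuous fun b : EuclideanSpace ℝ (Fin l) × EuclideanSpace ℝ (Fin n) =>
      F b.1 b.2 := by
    simp only [hF]
    fun_prop
  simp_rw [hfF]
  rw [setAverage_add_of_continuous _ _ _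
      (f := fun b : EuclideanSpace ℝ (Fin l) × EuclideanSpace ℝ (Fin n) => lam * F b.1 b.2)
      (g := fun _ => (Fintype.card ι : ℝ) / 2 * c)
      (by fun_prop) (by fun_prop),
    setAverage_const_mul, setAverage_closedBall_bilinear _ F hFc _ (by norm_num),
    setAverage_const_closedBall _ _ (by norm_num), Module.finrank_prod,
    finrank_euclideanSpace_fin, finrank_euclideanSpace_fin]
  norm_num at hlt ⊢
  simpa [hF] using hlt

/-- Bound for the norm of the product of two independent Gaussian matrices. -/
theorem measure_exists_sum_inner_mul_inner_gt_sqrt_le {ι : Type*} [Fintype ι] {n l : ℕ}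
    (hn : 0 < n) (hl : 0 < l) {δ : ℝ} (hδ : 0 < δ) (hδ4 : δ ≤ 1 / 4)
    (ht : 2 * ((n : ℝ) + l) * Real.log (1 / δ) ≤ (Fintype.card ι : ℝ)) :
    Measure.pi (fun _ : ι => (stdGaussian (EuclideanSpace ℝ (Fin n))).prod
        (stdGaussian (EuclideanSpace ℝ (Fin l))))
      {w | ∃ (u : EuclideanSpace ℝ (Fin l)) (v : EuclideanSpace ℝ (Fin n)), ‖u‖ ≤ 1 ∧ ‖v‖ ≤ 1 ∧
        4 * √((Fintype.card ι : ℝ)) * √(((n : ℝ) + l) * Real.log (9 / δ)) <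
          ∑ j, inner ℝ u (w j).2 * inner ℝ v (w j).1}
      ≤ ENNReal.ofReal δ := by
  have hn' : (1 : ℝ) ≤ n := by exact_mod_cast hn
  have hl' : (1 : ℝ) ≤ l := by exact_mod_cast hl
  set t : ℝ := (Fintype.card ι : ℝ)
  set N : ℝ := (n : ℝ) + l with hN
  set D := Real.log (1 / δ) with hD
  have hD1 : 1 ≤ D := by
    rw [hD, Real.le_log_iff_exp_le (by positivity)]
    have : 4 ≤ 1 / δ := by rw [le_div_iff₀ hδ]; linarith
    linarith [Real.exp_one_lt_d9]
  have hD3 : Real.log 3 ≤ D := by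
    refine Real.log_le_log (by norm_num) ?_
    rw [le_div_iff₀ hδ]; linarith
  have hlog3 : 0 < Real.log 3 := Real.log_pos (by norm_num)
  have hlog : Real.log (9 / δ) = 2 * Real.log 3 + D := by
    rw [hD, show 9 / δ = 3 ^ 2 * (1 / δ) by ring, Real.log_mul (by norm_num) (by positivity),
      Real.log_pow]; norm_num
  have ht0 : 0 < t := lt_of_lt_of_le (by positivity) ht
  -- Taking `lam = 2/9 √q` makes `lam² · 81/16 = q/4`. The gain `8/9 qt` minus the logarithmic cost
  -- `qt/4` exceeds `qt/2`, which covers the entropy. The condition on `t` gives `q ≤ 3/2`, keeping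
  -- `q/4` below `1/2`.
  set q : ℝ := N * Real.log (9 / δ) / t with hq
  have hqt : q * t = N * Real.log (9 / δ) := div_mul_cancel₀ _ ht0.ne'
  have hN2 : 2 ≤ N := by rw [hN]; linarith
  have hq0 : 0 < q := by rw [hq, hlog]; positivity
  have hq1 : q ≤ 3 / 2 := by
    rw [hq, div_le_iff₀ ht0, hlog]
    nlinarith
  have hsq : (2 / 9 * √q) ^ 2 * (81 / 16) = q / 4 := by
    rw [mul_pow, Real.sq_sqrt hq0.le]; ring
  refine (measure_mono ?_).trans (measure_exists_sum_inner_mul_inner_gt_le (ι := ι) (l := l) hn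
    (lam := 2 / 9 * √q) hδ (by rw [hsq]; linarith))
  rintro w ⟨u, v, hu, hv, hlt⟩
  refine ⟨u, v, hu, hv, ?_⟩
  rw [hsq]
  have hlogq := neg_two_mul_le_log_one_sub (x := q / 4) (by linarith) (by linarith)
  have h4 : 4 * √t * √(N * Real.log (9 / δ)) = 4 * t * √q := by
    rw [← hqt, Real.sqrt_mul hq0.le]
    rw [show 4 * √t * (√q * √t) = 4 * (√t * √t) * √q by ring, Real.mul_self_sqrt ht0.le]
  rw [h4] at hlt
  have hsqrt : 0 < √q := Real.sqrt_pos.2 hq0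
  have h5 := mul_lt_mul_of_pos_left hlt (by positivity : 0 < 2 / 9 * √q)
  have h6 : 2 / 9 * √q * (4 * t * √q) = 8 / 9 * (q * t) := by
    nlinarith [Real.mul_self_sqrt hq0.le]
  have h7 : t / 2 * (-(2 * (q / 4))) ≤ t / 2 * Real.log (1 - q / 4) :=
    mul_le_mul_of_nonneg_left hlogq (by positivity)
  have h8 : ((l + n : ℕ) : ℝ) * Real.log 3 + D ≤ 1 / 2 * (q * t) := by
    rw [hqt, hlog]; push_cast
    nlinarith
  have h9 : 0 < q * t := by positivity
  linarith

/-! ### Deterministic matrix bounds -/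

theorem ofLp_dotProduct_ofLp {n : ℕ} (u v : EuclideanSpace ℝ (Fin n)) :
    u.ofLp ⬝ᵥ v.ofLp = inner ℝ u v := by
  rw [EuclideanSpace.inner_eq_star_dotProduct, star_trivial, dotProduct_comm]

theorem dotProduct_outerSum_mulVec {p q : ℕ} (a : ℕ+ → EuclideanSpace ℝ (Fin p))
    (b : ℕ+ → EuclideanSpace ℝ (Fin q)) (t : ℕ+) (u : EuclideanSpace ℝ (Fin p))
    (v : EuclideanSpace ℝ (Fin q)) :
    u.ofLp ⬝ᵥ (outerSum a b t *ᵥ v.ofLp)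
      = ∑ j : Finset.Icc 1 t, inner ℝ u (a j) * inner ℝ v (b j) := by
  rw [outerSum, Matrix.sum_mulVec, dotProduct_sum, ← Finset.sum_coe_sort]
  refine Finset.sum_congr rfl fun j _ => ?_
  rw [Matrix.vecMulVec_mulVec, dotProduct_smul, ofLp_dotProduct_ofLp, ofLp_dotProduct_ofLp,
    op_smul_eq_mul, real_inner_comm v]

theorem l2_opNorm_le_of_mulVec {p q : ℕ} (A : Matrix (Fin p) (Fin q) ℝ) {C : ℝ} (hC : 0 ≤ C)
    (h : ∀ v : EuclideanSpace ℝ (Fin q), ‖WithLp.toLp 2 (A *ᵥ v.ofLp)‖ ≤ C * ‖v‖) : ‖A‖ ≤ C := by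
  rw [Matrix.l2_opNorm_def]
  exact ContinuousLinearMap.opNorm_le_bound _ hC h

theorem l2_opNorm_le_of_dotProduct {p q : ℕ} (A : Matrix (Fin p) (Fin q) ℝ) {C : ℝ} (hC : 0 ≤ C)
    (h : ∀ (u : EuclideanSpace ℝ (Fin p)) (v : EuclideanSpace ℝ (Fin q)), ‖u‖ ≤ 1 → ‖v‖ ≤ 1 →
      u.ofLp ⬝ᵥ (A *ᵥ v.ofLp) ≤ C) : ‖A‖ ≤ C := by
  rw [Matrix.l2_opNorm_def]
  refine ContinuousLinearMap.opNorm_le_of_unit_norm hC fun v hv => ?_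
  set w : EuclideanSpace ℝ (Fin p) := WithLp.toLp 2 (A *ᵥ v.ofLp) with hw
  change ‖w‖ ≤ C
  have h0 : ‖‖w‖⁻¹ • w‖ ≤ 1 := by
    rw [norm_smul, norm_inv, norm_norm]
    exact inv_mul_le_one
  have h1 := h (‖w‖⁻¹ • w) v h0 hv.le
  have h2 : (‖w‖⁻¹ • w).ofLp ⬝ᵥ (A *ᵥ v.ofLp) = ‖w‖ := by
    have : (‖w‖⁻¹ • w).ofLp ⬝ᵥ w.ofLp = ‖w‖ := by
      rw [ofLp_dotProduct_ofLp, real_inner_smul_left, real_inner_self_eq_norm_sq]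
      rcases eq_or_ne ‖w‖ 0 with h0 | h0
      · simp [h0]
      · field_simp
    exact this
  rwa [h2] at h1

/-- Coercivity and Cauchy-Schwarz give `c‖u‖ ≤ ‖Au‖`, hence injectivity, and the norm bound at `u =
A⁻¹v`. -/
theorem isUnit_and_norm_inv_le {n : ℕ} (A : Matrix (Fin n) (Fin n) ℝ) {c : ℝ} (hc : 0 < c)
    (h : ∀ u : EuclideanSpace ℝ (Fin n), c * ‖u‖ ^ 2 ≤ u.ofLp ⬝ᵥ (A *ᵥ u.ofLp)) :
    IsUnit A ∧ ‖A⁻¹‖ ≤ 1 / c := by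
  have hle : ∀ u : EuclideanSpace ℝ (Fin n), c * ‖u‖ ≤ ‖WithLp.toLp 2 (A *ᵥ u.ofLp)‖ := by
    intro u
    have h1 := (h u).trans ((ofLp_dotProduct_ofLp u (WithLp.toLp 2 (A *ᵥ u.ofLp))).le.trans
      (real_inner_le_norm _ _))
    rcases (norm_nonneg u).eq_or_lt with h0 | h0
    · rw [← h0]; simp
    · nlinarith
  have hU : IsUnit A := by
    rw [← Matrix.mulVec_injective_iff_isUnit, ← Matrix.coe_mulVecLin,
      injective_iff_map_eq_zero]
    intro u hu
    have := hle (WithLp.toLp 2 u)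
    rw [Matrix.mulVecLin_apply] at hu
    simp only [hu, WithLp.toLp_zero, norm_zero] at this
    have h0 : ‖WithLp.toLp 2 u‖ = 0 := le_antisymm (by nlinarith) (norm_nonneg _)
    simpa using h0
  refine ⟨hU, l2_opNorm_le_of_mulVec _ (by positivity) fun v => ?_⟩
  have h1 := hle (WithLp.toLp 2 (A⁻¹ *ᵥ v.ofLp))
  simp only [Matrix.mulVec_mulVec,
    Matrix.mul_nonsing_inv A ((Matrix.isUnit_iff_isUnit_det A).1 hU), Matrix.one_mulVec] at h1
  rw [div_mul_eq_mul_div, one_mul, le_div_iff₀ hc, mul_comm]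
  exact h1

-- Subtracting `lambdaMin A • 1` translates the spectrum into the nonnegative reals, so the
-- difference is positive semidefinite.
open scoped Pointwise in
theorem lambdaMin_mul_norm_sq_le {n : ℕ} (hn : 0 < n) {A : Matrix (Fin n) (Fin n) ℝ}
    (hA : A.PosSemidef) (u : EuclideanSpace ℝ (Fin n)) :
    lambdaMin A * ‖u‖ ^ 2 ≤ u.ofLp ⬝ᵥ (A *ᵥ u.ofLp) := by
  have hB : (A - lambdaMin A • (1 : Matrix (Fin n) (Fin n) ℝ)).IsHermitian :=
    hA.isHermitian.sub (by simp [Matrix.IsHermitian])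
  have hP : (A - lambdaMin A • (1 : Matrix (Fin n) (Fin n) ℝ)).PosSemidef := by
    rw [hB.posSemidef_iff_eigenvalues_nonneg]
    intro i
    have hm : hB.eigenvalues i ∈ spectrum ℝ A - ({lambdaMin A} : Set ℝ) := by
      rw [spectrum.sub_singleton_eq, Algebra.algebraMap_eq_smul_one]
      exact hB.eigenvalues_mem_spectrum_real i
    obtain ⟨ν, hν, c, hc, hνc⟩ := hm
    rw [Set.mem_singleton_iff] at hc
    have := ((lambdaMin_spec hn A hA).2 ν hν).1
    simp only at hνc
    rw [Pi.zero_apply, ← hνc]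
    linarith
  have h := hP.dotProduct_mulVec_nonneg u.ofLp
  rw [star_trivial, Matrix.sub_mulVec, dotProduct_sub, Matrix.smul_mulVec, Matrix.one_mulVec,
    dotProduct_smul, ofLp_dotProduct_ofLp u u, real_inner_self_eq_norm_sq, smul_eq_mul] at h
  linarith

theorem posSemidef_outerSum_self {n : ℕ} (μ : ℕ+ → EuclideanSpace ℝ (Fin n)) (t : ℕ+) :
    (outerSum μ μ t).PosSemidef :=
  Matrix.posSemidef_sum _ fun j _ => Matrix.posSemidef_vecMulVec_self_star (μ j).ofLp

theorem posDef_one_add_muBar {n : ℕ} (σx : ℝ) (μ : ℕ+ → EuclideanSpace ℝ (Fin n)) (t : ℕ+) :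
    (1 + muBar σx μ t).PosDef :=
  Matrix.PosDef.one.add_posSemidef ((posSemidef_outerSum_self μ t).smul (by positivity))

theorem lambdaMin_pos {n : ℕ} (hn : 0 < n) {A : Matrix (Fin n) (Fin n) ℝ} (hA : A.PosDef) :
    0 < lambdaMin A := by
  have h := (lambdaMin_spec hn A hA.posSemidef).1
  rw [hA.isHermitian.spectrum_real_eq_range_eigenvalues] at h
  obtain ⟨i, hi⟩ := h
  rw [← hi]
  exact hA.eigenvalues_pos i

/-- Cauchy-Schwarz: the bilinear form of `∑ h_j μ_jᵀ` is bounded by its Frobenius norm. -/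
theorem abs_sum_inner_mul_inner_le {ι : Type*} [Fintype ι] {n : ℕ} {V : Type*}
    [NormedAddCommGroup V] [InnerProductSpace ℝ V] (h : ι → V) (μ : ι → EuclideanSpace ℝ (Fin n))
    (u : V) (v : EuclideanSpace ℝ (Fin n)) :
    |∑ j, inner ℝ u (h j) * inner ℝ v (μ j)|
      ≤ ‖u‖ * (‖v‖ * √(∑ a, ‖∑ j, μ j a • h j‖ ^ 2)) := by
  have h1 : ∑ j, inner ℝ u (h j) * inner ℝ v (μ j) = inner ℝ u (∑ a, v a • ∑ j, μ j a • h j) := by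
    simp_rw [inner_sum, inner_smul_right, inner_sum, inner_smul_right, Finset.mul_sum]
    rw [Finset.sum_comm]
    refine Finset.sum_congr rfl fun j _ => ?_
    rw [PiLp.inner_apply, Finset.mul_sum]
    refine Finset.sum_congr rfl fun a _ => ?_
    simp
    ring
  rw [h1]
  refine (abs_real_inner_le_norm _ _).trans (mul_le_mul_of_nonneg_left ?_ (norm_nonneg _))
  refine (norm_sum_le _ _).trans ?_
  simp_rw [norm_smul, Real.norm_eq_abs]
  refine (Real.sum_mul_le_sqrt_mul_sqrt _ _ _).trans (le_of_eq ?_)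
  rw [EuclideanSpace.norm_eq]
  simp

theorem lsEstimate_sub_eq {n l : ℕ} (Θ : Matrix (Fin l) (Fin n) ℝ)
    (x : ℕ+ → EuclideanSpace ℝ (Fin n)) (η y : ℕ+ → EuclideanSpace ℝ (Fin l)) (t : ℕ+)
    (hy : ∀ j, y j = WithLp.toLp 2 (Θ *ᵥ (x j).ofLp) + η j) (hU : IsUnit (outerSum x x t)) :
    lsEstimate x y t - Θ = outerSum η x t * (outerSum x x t)⁻¹ := by
  have h1 : outerSum y x t = Θ * outerSum x x t + outerSum η x t := by
    simp only [outerSum]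
    rw [Matrix.mul_sum, ← Finset.sum_add_distrib]
    refine Finset.sum_congr rfl fun j _ => ?_
    rw [Matrix.mul_vecMulVec, hy, ← Matrix.add_vecMulVec]
    rfl
  rw [lsEstimate, h1, Matrix.add_mul, Matrix.mul_assoc,
    Matrix.mul_nonsing_inv _ ((Matrix.isUnit_iff_isUnit_det _).1 hU), Matrix.mul_one,
    add_sub_cancel_left]

theorem isUnit_and_norm_lsEstimate_sub_le {n l : ℕ} (Θ : Matrix (Fin l) (Fin n) ℝ)
    (x : ℕ+ → EuclideanSpace ℝ (Fin n)) (η y : ℕ+ → EuclideanSpace ℝ (Fin l)) (t : ℕ+)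
    (hy : ∀ j, y j = WithLp.toLp 2 (Θ *ᵥ (x j).ofLp) + η j) {c K : ℝ} (hc : 0 < c) (hK : 0 ≤ K)
    (hlow : ∀ u, c * ‖u‖ ^ 2 ≤ ∑ j : Finset.Icc 1 t, (inner ℝ u (x j)) ^ 2)
    (hup : ∀ u v, ‖u‖ ≤ 1 → ‖v‖ ≤ 1 →
      ∑ j : Finset.Icc 1 t, inner ℝ u (η j) * inner ℝ v (x j) ≤ K) :
    IsUnit (outerSum x x t) ∧ ‖lsEstimate x y t - Θ‖ ≤ K / c := by
  obtain ⟨hU, hinv⟩ := isUnit_and_norm_inv_le (outerSum x x t) hc fun u => by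
    rw [dotProduct_outerSum_mulVec]
    simpa only [← sq] using hlow u
  refine ⟨hU, ?_⟩
  rw [lsEstimate_sub_eq Θ x η y t hy hU, div_eq_mul_one_div]
  refine (Matrix.l2_opNorm_mul _ _).trans (mul_le_mul ?_ hinv (norm_nonneg _) hK)
  refine l2_opNorm_le_of_dotProduct _ hK fun u v hu hv => ?_
  rw [dotProduct_outerSum_mulVec]
  exact hup u v hu hv

/-! ### Standardisation and the Gram lower bound -/

section
open scoped MatrixOrder

theorem multivariateGaussian_sq_smul_one {n : ℕ} (μ : EuclideanSpace ℝ (Fin n)) {σ : ℝ}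
    (hσ : 0 ≤ σ) :
    multivariateGaussian μ (σ ^ 2 • (1 : Matrix (Fin n) (Fin n) ℝ))
      = (stdGaussian (EuclideanSpace ℝ (Fin n))).map fun g => μ + σ • g := by
  have hs : CFC.sqrt (σ ^ 2 • (1 : Matrix (Fin n) (Fin n) ℝ)) = σ • 1 := by
    refine CFC.sqrt_unique ?_ (smul_nonneg hσ zero_le_one)
    rw [smul_mul_smul_comm, one_mul, sq]
  rw [multivariateGaussian, hs]
  congr 1
  ext g
  simp

end

theorem sum_sum_sq_le {ι : Type*} [Fintype ι] {n : ℕ} (μ : ι → EuclideanSpace ℝ (Fin n)) {μhat : ℝ}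
    (hμ : ∀ j, ‖μ j‖ ≤ μhat) : ∑ a, ∑ j, μ j a ^ 2 ≤ (Fintype.card ι : ℝ) * μhat ^ 2 := by
  rw [Finset.sum_comm]
  calc ∑ j, ∑ a, μ j a ^ 2 = ∑ j, ‖μ j‖ ^ 2 :=
        Finset.sum_congr rfl fun j _ => (EuclideanSpace.real_norm_sq_eq _).symm
    _ ≤ ∑ _j : ι, μhat ^ 2 := Finset.sum_le_sum fun j _ => by
        have := hμ j
        gcongr
    _ = _ := by simp

theorem sqrt_le_of_frobenius {F S R T μhat : ℝ} (hR : 0 ≤ R) (hμ : 0 ≤ μhat) (hT : 0 ≤ T)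
    (hF : F ≤ R ^ 2 * S) (hS : S ≤ T * μhat ^ 2) : √F ≤ R * (√T * μhat) := by
  refine Real.sqrt_le_iff.2 ⟨by positivity, hF.trans ?_⟩
  rw [mul_pow, mul_pow, Real.sq_sqrt hT]
  gcongr

theorem le_sum_inner_sq_of_unit {ι : Type*} [Fintype ι] {V : Type*} [NormedAddCommGroup V]
    [InnerProductSpace ℝ V] {g : ι → V} {c : ℝ}
    (h : ∀ u, ‖u‖ = 1 → c ≤ ∑ j, (inner ℝ (g j) u) ^ 2) (u : V) :
    c * ‖u‖ ^ 2 ≤ ∑ j, (inner ℝ (g j) u) ^ 2 := by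
  rcases eq_or_ne u 0 with rfl | hu
  · simp
  have hu0 : 0 < ‖u‖ := norm_pos_iff.2 hu
  have h1 := h (‖u‖⁻¹ • u) (by rw [norm_smul, norm_inv, norm_norm, inv_mul_cancel₀ hu0.ne'])
  simp_rw [real_inner_smul_right, mul_pow, ← Finset.mul_sum] at h1
  rw [inv_pow, inv_mul_eq_div, le_div_iff₀ (by positivity)] at h1
  exact h1

/-- Expanding the square, the cross term costs at most `Tσ²/8 ‖u‖²` out of the Gaussian part `Tσ²/4
‖u‖²`. The remaining `Tσ²/8 ‖u‖²`, with half of `∑ ⟨u,μ⟩²`, is exactly `Tσ²/8` times the form of `I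
+ μ̄`. -/
theorem gram_lower_bound {ι : Type*} [Fintype ι] {V : Type*} [NormedAddCommGroup V]
    [InnerProductSpace ℝ V] {g μ : ι → V} {σ T lam : ℝ} (hσ : 0 < σ) (hT : 0 < T) (u : V)
    (hlam : lam * ‖u‖ ^ 2 ≤ ‖u‖ ^ 2 + 4 / (T * σ ^ 2) * ∑ j, (inner ℝ u (μ j)) ^ 2)
    (hg : T / 4 * ‖u‖ ^ 2 ≤ ∑ j, (inner ℝ (g j) u) ^ 2)
    (hgμ : |∑ j, inner ℝ u (g j) * inner ℝ u (μ j)| ≤ T * σ / 16 * ‖u‖ ^ 2) :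
    T * σ ^ 2 / 8 * lam * ‖u‖ ^ 2 ≤ ∑ j, (inner ℝ u (μ j + σ • g j)) ^ 2 := by
  have h1 : ∑ j, (inner ℝ u (μ j + σ • g j)) ^ 2 = ∑ j, (inner ℝ u (μ j)) ^ 2
      + 2 * σ * ∑ j, inner ℝ u (g j) * inner ℝ u (μ j) + σ ^ 2 * ∑ j, (inner ℝ (g j) u) ^ 2 := by
    rw [Finset.mul_sum, Finset.mul_sum, ← Finset.sum_add_distrib, ← Finset.sum_add_distrib]
    refine Finset.sum_congr rfl fun j _ => ?_
    rw [inner_add_right, inner_smul_right, real_inner_comm u (g j)]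
    ring
  have h2 : T * σ ^ 2 / 8 * (4 / (T * σ ^ 2) * ∑ j, (inner ℝ u (μ j)) ^ 2)
      = 1 / 2 * ∑ j, (inner ℝ u (μ j)) ^ 2 := by
    field_simp; ring
  have h3 : 0 ≤ ∑ j, (inner ℝ u (μ j)) ^ 2 := Finset.sum_nonneg fun j _ => sq_nonneg _
  have h4 := mul_le_mul_of_nonneg_left hlam (by positivity : 0 ≤ T * σ ^ 2 / 8)
  rw [mul_add, h2] at h4
  have h5 := mul_le_mul_of_nonneg_left (abs_le.1 hgμ).1 (by positivity : 0 ≤ 2 * σ)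
  have h6 := mul_le_mul_of_nonneg_left hg (by positivity : 0 ≤ σ ^ 2)
  rw [h1]
  nlinarith

theorem exp_neg_sqrt_sq_div_two {δ : ℝ} (hδ : 0 < δ) (hδ1 : δ ≤ 1) :
    Real.exp (-√(2 * Real.log (2 / δ)) ^ 2 / 2) = δ / 2 := by
  have : 0 ≤ Real.log (2 / δ) := Real.log_nonneg (by rw [le_div_iff₀ hδ]; linarith)
  rw [Real.sq_sqrt (by positivity), show -(2 * Real.log (2 / δ)) / 2 = -Real.log (2 / δ) by ring,
    Real.exp_neg, Real.exp_log (by positivity), inv_div]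

/-! ### Union bound and conclusion -/

/-- With high probability, the quadratic form of the sample covariance is bounded below and the
bilinear form of the noise-feature correlation is bounded above. -/
theorem measure_compl_good_le {ι : Type*} [Fintype ι] {n l : ℕ} (hn : 0 < n) (hl : 0 < l)
    {σx ση μhat lam δ : ℝ} (hσx : 0 < σx) (hση : 0 ≤ ση) (μ : ι → EuclideanSpace ℝ (Fin n))
    (hμ0 : 0 ≤ μhat) (hμ : ∀ j, ‖μ j‖ ≤ μhat) (hδ : 0 < δ) (hδ4 : δ ≤ 1 / 4)
    (hlam : ∀ u, lam * ‖u‖ ^ 2 ≤ ‖u‖ ^ 2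
      + 4 / ((Fintype.card ι : ℝ) * σx ^ 2) * ∑ j, (inner ℝ u (μ j)) ^ 2)
    (hT : 0 < (Fintype.card ι : ℝ))
    (ht₁ : 8 * (n : ℝ) + 16 * Real.log (2 / δ) ≤ (Fintype.card ι : ℝ))
    (ht₂ : (16 * μhat * (√(4 * (n : ℝ)) + √(2 * Real.log (2 / δ))) / σx) ^ 2
      ≤ (Fintype.card ι : ℝ))
    (ht₃ : 2 * ((n : ℝ) + l) * Real.log (1 / δ) ≤ (Fintype.card ι : ℝ)) :
    Measure.pi (fun _ : ι => (stdGaussian (EuclideanSpace ℝ (Fin n))).prod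
        (stdGaussian (EuclideanSpace ℝ (Fin l))))
      {w | ¬ ((∀ u, (Fintype.card ι : ℝ) * σx ^ 2 / 8 * lam * ‖u‖ ^ 2
            ≤ ∑ j, (inner ℝ u (μ j + σx • (w j).1)) ^ 2) ∧
          ∀ u v, ‖u‖ ≤ 1 → ‖v‖ ≤ 1 →
            ∑ j, inner ℝ u (ση • (w j).2) * inner ℝ v (μ j + σx • (w j).1)
              ≤ √(Fintype.card ι : ℝ) * constC1 n l σx ση μhat δ / 8)}
      ≤ ENNReal.ofReal (4 * δ) := by
  set T : ℝ := (Fintype.card ι : ℝ) with hTdef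
  set γn := stdGaussian (EuclideanSpace ℝ (Fin n)) with hγn
  set γl := stdGaussian (EuclideanSpace ℝ (Fin l)) with hγl
  set Q := Measure.pi (fun _ : ι => γn.prod γl) with hQ
  set D := Real.log (2 / δ) with hD
  set s : ℝ := √(2 * D) with hs
  have hD0 : 0 < D := Real.log_pos (by rw [lt_div_iff₀ hδ]; linarith)
  have hs0 : 0 < s := Real.sqrt_pos.2 (by positivity)
  have hfst : MeasurePreserving (fun (w : ι → EuclideanSpace ℝ (Fin n) × EuclideanSpace ℝ (Fin l))
      j => (w j).1) Q (Measure.pi fun _ : ι => γn) :=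
    measurePreserving_pi _ _ fun _ => measurePreserving_fst
  have hsnd : MeasurePreserving (fun (w : ι → EuclideanSpace ℝ (Fin n) × EuclideanSpace ℝ (Fin l))
      j => (w j).2) Q (Measure.pi fun _ : ι => γl) :=
    measurePreserving_pi _ _ fun _ => measurePreserving_snd
  have hA := measure_exists_sum_inner_sq_lt_le (ι := ι) hn hδ (by linarith) ht₁
  have hB := measure_sum_norm_sq_gt_le (ι := ι) hn (fun j a => μ j a) hs0
  have hC := measure_exists_sum_inner_mul_inner_gt_sqrt_le (ι := ι) hn hl hδ hδ4 ht₃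
  have hE := measure_sum_norm_sq_gt_le (ι := ι) hl (fun j a => μ j a) hs0
  rw [hs, hD, exp_neg_sqrt_sq_div_two hδ (by linarith), ← hD, ← hs] at hB hE
  set A := {g : ι → EuclideanSpace ℝ (Fin n) | ∃ u : EuclideanSpace ℝ (Fin n), ‖u‖ = 1 ∧
    ∑ j, (inner ℝ (g j) u) ^ 2 < T / 4} with hAdef
  set B := {g : ι → EuclideanSpace ℝ (Fin n) | (√n + s) ^ 2 * ∑ a, ∑ j, μ j a ^ 2
    < ∑ a, ‖∑ j, μ j a • g j‖ ^ 2} with hBdef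
  set E := {g : ι → EuclideanSpace ℝ (Fin l) | (√l + s) ^ 2 * ∑ a, ∑ j, μ j a ^ 2
    < ∑ a, ‖∑ j, μ j a • g j‖ ^ 2} with hEdef
  set C := {w : ι → EuclideanSpace ℝ (Fin n) × EuclideanSpace ℝ (Fin l) |
    ∃ (u : EuclideanSpace ℝ (Fin l)) (v : EuclideanSpace ℝ (Fin n)), ‖u‖ ≤ 1 ∧ ‖v‖ ≤ 1 ∧
        4 * √T * √(((n : ℝ) + l) * Real.log (9 / δ)) <
          ∑ j, inner ℝ u (w j).2 * inner ℝ v (w j).1} with hCdef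
  -- `Measure.le_map_apply` holds for arbitrary sets, so the exceptional events need not be shown
  -- measurable.
  have hA' : Q ((fun w j => (w j).1) ⁻¹' A) ≤ ENNReal.ofReal δ :=
    (Measure.le_map_apply hfst.measurable.aemeasurable A).trans (by rw [hfst.map_eq]; exact hA)
  have hB' : Q ((fun w j => (w j).1) ⁻¹' B) ≤ ENNReal.ofReal (δ / 2) :=
    (Measure.le_map_apply hfst.measurable.aemeasurable B).trans (by rw [hfst.map_eq]; exact hB)
  have hE' : Q ((fun w j => (w j).2) ⁻¹' E) ≤ ENNReal.ofReal (δ / 2) :=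
    (Measure.le_map_apply hsnd.measurable.aemeasurable E).trans (by rw [hsnd.map_eq]; exact hE)
  have hunion : Q (((fun w j => (w j).1) ⁻¹' A ∪ (fun w j => (w j).1) ⁻¹' B)
      ∪ (C ∪ (fun w j => (w j).2) ⁻¹' E)) ≤ ENNReal.ofReal (4 * δ) := by
    refine (measure_union_le _ _).trans ((add_le_add ((measure_union_le _ _).trans
      (add_le_add hA' hB')) ((measure_union_le _ _).trans (add_le_add hC hE'))).trans ?_)
    rw [← ENNReal.ofReal_add (by positivity) (by positivity),
      ← ENNReal.ofReal_add (by positivity) (by positivity)]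
    exact ENNReal.ofReal_le_ofReal (by linarith)
  refine (measure_mono fun w hw => ?_).trans hunion
  by_contra hnot
  simp only [Set.mem_union, Set.mem_preimage, not_or, hAdef, hBdef, hEdef, hCdef,
    Set.mem_ofPred_eq, not_exists, not_and, not_lt] at hnot
  obtain ⟨⟨hwA, hwB⟩, hwC, hwE⟩ := hnot
  refine hw ⟨fun u => ?_, fun u v hu hv => ?_⟩
  · refine gram_lower_bound hσx hT u (hlam u) (le_sum_inner_sq_of_unit hwA u)
      ((abs_sum_inner_mul_inner_le _ _ _ _).trans ?_)
    -- The Frobenius bound is `(√n + s)√T μhat`; `ht₂` is what makes it at most `Tσx/16`.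
    have h1 := sqrt_le_of_frobenius (by positivity) hμ0 hT.le hwB (sum_sum_sq_le μ hμ)
    have h2 : (√n + s) * (√T * μhat) ≤ T * σx / 16 := by
      have h3 : 16 * μhat * (√(4 * (n : ℝ)) + s) / σx ≤ √T := Real.le_sqrt_of_sq_le ht₂
      have h4 : √(n : ℝ) ≤ √(4 * (n : ℝ)) := Real.sqrt_le_sqrt (by linarith [n.cast_nonneg (α := ℝ)])
      rw [div_le_iff₀ hσx] at h3
      have h5 : μhat * (√n + s) ≤ μhat * (√(4 * (n : ℝ)) + s) := by gcongr
      have h6 : μhat * (√n + s) ≤ √T * σx / 16 := by linarith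
      have h7 := mul_le_mul_of_nonneg_left h6 (Real.sqrt_nonneg T)
      have h8 : √T * (√T * σx / 16) = T * σx / 16 := by
        rw [← mul_div_assoc, ← mul_assoc, Real.mul_self_sqrt hT.le]
      linarith
    calc ‖u‖ * (‖u‖ * √(∑ a, ‖∑ j, μ j a • (w j).1‖ ^ 2))
        = √(∑ a, ‖∑ j, μ j a • (w j).1‖ ^ 2) * ‖u‖ ^ 2 := by ring
      _ ≤ T * σx / 16 * ‖u‖ ^ 2 := by gcongr; exact h1.trans h2
  · have h1 : ∑ j, inner ℝ u (ση • (w j).2) * inner ℝ v (μ j + σx • (w j).1)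
        = ση * (∑ j, inner ℝ u (w j).2 * inner ℝ v (μ j)
          + σx * ∑ j, inner ℝ u (w j).2 * inner ℝ v (w j).1) := by
      rw [Finset.mul_sum, ← Finset.sum_add_distrib, Finset.mul_sum]
      refine Finset.sum_congr rfl fun j _ => ?_
      rw [inner_add_right, inner_smul_right, inner_smul_right]
      ring
    have h2 := sqrt_le_of_frobenius (by positivity) hμ0 hT.le hwE (sum_sum_sq_le μ hμ)
    have h3 : ∑ j, inner ℝ u (w j).2 * inner ℝ v (μ j) ≤ (√l + s) * (√T * μhat) := by
      refine (le_abs_self _).trans ((abs_sum_inner_mul_inner_le _ _ _ _).trans ?_)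
      refine le_trans ?_ h2
      rw [← mul_assoc]
      exact mul_le_of_le_one_left (Real.sqrt_nonneg _) (mul_le_one₀ hu (norm_nonneg _) hv)
    have h4 : √(l : ℝ) ≤ √(2 * ((l : ℝ) + n)) := Real.sqrt_le_sqrt (by
      linarith [n.cast_nonneg (α := ℝ), l.cast_nonneg (α := ℝ)])
    have h5 : s ≤ 2 * √D := by
      refine Real.sqrt_le_iff.2 ⟨by positivity, ?_⟩
      rw [mul_pow, Real.sq_sqrt hD0.le]
      linarith
    have h6 : (√l + s) * (√T * μhat) ≤ (√(2 * ((l : ℝ) + n)) + 2 * √D) * (√T * μhat) := by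
      gcongr
    have h7 := mul_le_mul_of_nonneg_left (hwC u v hu hv) hσx.le
    rw [h1, constC1, show √T * (8 * ση * (4 * σx * √(((n : ℝ) + l) * Real.log (9 / δ))
      + μhat * (√(2 * ((l : ℝ) + n)) + 2 * √D))) / 8
      = ση * ((√(2 * ((l : ℝ) + n)) + 2 * √D) * (√T * μhat)
        + σx * (4 * √T * √(((n : ℝ) + l) * Real.log (9 / δ)))) by ring]
    exact mul_le_mul_of_nonneg_left (by linarith) hση

/-- An uncountable intersection of closed conditions; closedness supplies the measurability needed
to transfer the bound from the Gaussian model to `P`. -/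
theorem isClosed_good {ι : Type*} [Fintype ι] {n l : ℕ} (c K : ℝ) :
    IsClosed {w : ι → EuclideanSpace ℝ (Fin n) × EuclideanSpace ℝ (Fin l) |
      (∀ u, c * ‖u‖ ^ 2 ≤ ∑ j, (inner ℝ u (w j).1) ^ 2) ∧
        ∀ u v, ‖u‖ ≤ 1 → ‖v‖ ≤ 1 → ∑ j, inner ℝ u (w j).2 * inner ℝ v (w j).1 ≤ K} := by
  simp only [Set.ofPred_and, Set.ofPred_forall]
  refine (isClosed_iInter fun u => isClosed_le (by fun_prop) (by fun_prop)).inter ?_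
  exact isClosed_iInter fun u => isClosed_iInter fun v => isClosed_iInter fun _ =>
    isClosed_iInter fun _ => isClosed_le (by fun_prop) (by fun_prop)

theorem hasLaw_pi_gaussian {Ω ι : Type*} [MeasurableSpace Ω] {P : Measure Ω}
    [IsProbabilityMeasure P] [Fintype ι] {n l : ℕ} {σx ση : ℝ} (hσx : 0 ≤ σx) (hση : 0 ≤ ση)
    (μ : ι → EuclideanSpace ℝ (Fin n)) (x : ι → Ω → EuclideanSpace ℝ (Fin n))
    (η : ι → Ω → EuclideanSpace ℝ (Fin l))
    (hx : ∀ j, HasLaw (x j)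
      (multivariateGaussian (μ j) (σx ^ 2 • (1 : Matrix (Fin n) (Fin n) ℝ))) P)
    (hη : ∀ j, HasLaw (η j)
      (multivariateGaussian 0 (ση ^ 2 • (1 : Matrix (Fin l) (Fin l) ℝ))) P)
    (hindep : iIndepFun (fun j ω => (x j ω, η j ω)) P)
    (hindep_pair : ∀ j, IndepFun (x j) (η j) P) :
    HasLaw (fun ω j => (x j ω, η j ω))
      ((Measure.pi fun _ : ι => (stdGaussian (EuclideanSpace ℝ (Fin n))).prod
        (stdGaussian (EuclideanSpace ℝ (Fin l)))).map
          fun w j => (μ j + σx • (w j).1, ση • (w j).2)) P := by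
  have h := hindep.hasLaw_pi fun j => (hindep_pair j).hasLaw_prod (hx j) (hη j)
  convert h using 1
  rw [Measure.pi_map_pi (f := fun j (p : EuclideanSpace ℝ (Fin n) × EuclideanSpace ℝ (Fin l)) =>
    (μ j + σx • p.1, ση • p.2)) fun j => Measurable.aemeasurable (by fun_prop)]
  congr 1
  ext1 j
  rw [multivariateGaussian_sq_smul_one _ hσx, multivariateGaussian_sq_smul_one _ hση,
    Measure.map_prod_map _ _ (by fun_prop) (by fun_prop)]
  simp only [zero_add]
  rfl

theorem theorem1
    {Ω : Type*} [MeasurableSpace Ω] (P : Measure Ω) [IsProbabilityMeasure P]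
    {m n l : ℕ} (hn : 0 < n) (hl : 0 < l)
    (Θ : Matrix (Fin l) (Fin n) ℝ)
    (σx ση μhat : ℝ) (hσx : 0 < σx) (hση : 0 ≤ ση)
    (μ : Fin m → ℕ+ → EuclideanSpace ℝ (Fin n))
    (hμ : IsLUB (Set.range fun p : Fin m × ℕ+ => ‖μ p.1 p.2‖) μhat)
    (x : Fin m → ℕ+ → Ω → EuclideanSpace ℝ (Fin n))
    (η y : Fin m → ℕ+ → Ω → EuclideanSpace ℝ (Fin l))
    -- the laws of the features and of the noise
    (hx : ∀ i t, HasLaw (x i t)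
      (multivariateGaussian (μ i t) (σx ^ 2 • (1 : Matrix (Fin n) (Fin n) ℝ))) P)
    (hη : ∀ i t, HasLaw (η i t)
      (multivariateGaussian 0 (ση ^ 2 • (1 : Matrix (Fin l) (Fin l) ℝ))) P)
    -- all the features and noises are mutually independent: the pairs `(x i t, η i t)` are
    -- independent over agents and times, and the two members of each pair are independent
    (hindep : iIndepFun (fun (p : Fin m × ℕ+) (ω : Ω) => (x p.1 p.2 ω, η p.1 p.2 ω)) P)
    (hindep_pair : ∀ i t, IndepFun (x i t) (η i t) P)
    -- the observation model `y = Θ x + η`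
    (hy : ∀ i t ω, y i t ω = WithLp.toLp 2 (Θ *ᵥ (x i t ω).ofLp) + η i t ω)
    (δ : ℝ) (hδ : 0 < δ) (t : ℕ+)
    (ht₁ : 8 * (n : ℝ) + 16 * Real.log (2 / δ) ≤ ((t : ℕ) : ℝ))
    (ht₂ : (16 * μhat * (√(4 * (n : ℝ)) + √(2 * Real.log (2 / δ))) / σx) ^ 2 ≤ ((t : ℕ) : ℝ))
    (ht₃ : 2 * ((n : ℝ) + l) * Real.log (1 / δ) ≤ ((t : ℕ) : ℝ))
    (i : Fin m) :
    ENNReal.ofReal (1 - 4 * δ) ≤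
      P {ω | IsUnit (outerSum (fun j => x i j ω) (fun j => x i j ω) t) ∧
        ‖lsEstimate (fun j => x i j ω) (fun j => y i j ω) t - Θ‖ ≤
          constC1 n l σx ση μhat δ /
            (√((t : ℕ) : ℝ) * σx ^ 2 * lambdaMin (1 + muBar σx (μ i) t))} := by

  rcases lt_or_ge (1 / 4) δ with hδ4 | hδ4
  · rw [ENNReal.ofReal_of_nonpos (by linarith)]
    exact zero_le
  have hcard : (Fintype.card (Finset.Icc 1 t) : ℝ) = ((t : ℕ) : ℝ) := by
    rw [Fintype.card_coe, PNat.card_Icc]; simp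
  have ht0 : (0 : ℝ) < ((t : ℕ) : ℝ) := by exact_mod_cast t.pos
  have hμle : ∀ j, ‖μ i j‖ ≤ μhat := fun j => hμ.1 ⟨(i, j), rfl⟩
  have hμ0 : 0 ≤ μhat := (norm_nonneg _).trans (hμle 1)
  have hpd := posDef_one_add_muBar σx (μ i) t
  set lam := lambdaMin (1 + muBar σx (μ i) t) with hlam
  have hlam0 : 0 < lam := lambdaMin_pos hn hpd
  have hlamle : ∀ u : EuclideanSpace ℝ (Fin n), lam * ‖u‖ ^ 2 ≤ ‖u‖ ^ 2
      + 4 / (((t : ℕ) : ℝ) * σx ^ 2) * ∑ j : Finset.Icc 1 t, (inner ℝ u (μ i j)) ^ 2 := by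
    intro u
    refine (lambdaMin_mul_norm_sq_le hn hpd.posSemidef u).trans (le_of_eq ?_)
    rw [muBar, Matrix.add_mulVec, Matrix.one_mulVec, dotProduct_add, Matrix.smul_mulVec,
      dotProduct_smul, dotProduct_outerSum_mulVec, ofLp_dotProduct_ofLp,
      real_inner_self_eq_norm_sq, smul_eq_mul]
    simp_rw [← sq]
  set c : ℝ := ((t : ℕ) : ℝ) * σx ^ 2 / 8 * lam with hc
  set K : ℝ := √((t : ℕ) : ℝ) * constC1 n l σx ση μhat δ / 8 with hK
  have hc0 : 0 < c := by positivity
  have hK0 : 0 ≤ K := by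
    rw [hK, constC1]; positivity
  set G := {w : Finset.Icc 1 t → EuclideanSpace ℝ (Fin n) × EuclideanSpace ℝ (Fin l) |
      (∀ u, c * ‖u‖ ^ 2 ≤ ∑ j, (inner ℝ u (w j).1) ^ 2) ∧
        ∀ u v, ‖u‖ ≤ 1 → ‖v‖ ≤ 1 → ∑ j, inner ℝ u (w j).2 * inner ℝ v (w j).1 ≤ K} with hG
  have hGm : MeasurableSet G := (isClosed_good c K).measurableSet
  have hlaw := hasLaw_pi_gaussian (P := P) hσx.le hση (fun j : Finset.Icc 1 t => μ i j)
    (fun j => x i j) (fun j => η i j) (fun j => hx i j) (fun j => hη i j)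
    (hindep.precomp (g := fun j : Finset.Icc 1 t => (i, (j : ℕ+)))
      fun a b hab => Subtype.ext (Prod.ext_iff.1 hab).2) (fun j => hindep_pair i j)
  have hbad : P ((fun ω (j : Finset.Icc 1 t) => (x i j ω, η i j ω)) ⁻¹' Gᶜ)
      ≤ ENNReal.ofReal (4 * δ) := by
    rw [← Measure.map_apply_of_aemeasurable hlaw.aemeasurable hGm.compl, hlaw.map_eq,
      Measure.map_apply (by fun_prop) hGm.compl]
    have h := measure_compl_good_le (ι := Finset.Icc 1 t) (lam := lam) hn hl hσx hση
      (fun j => μ i j) hμ0 (fun j => hμle j) hδ hδ4 (by rw [hcard]; exact hlamle)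
      (by rw [hcard]; exact ht0) (by rw [hcard]; exact ht₁) (by rw [hcard]; exact ht₂)
      (by rw [hcard]; exact ht₃)
    rw [hcard] at h
    exact h
  have hsub : (fun ω (j : Finset.Icc 1 t) => (x i j ω, η i j ω)) ⁻¹' G
      ⊆ {ω | IsUnit (outerSum (fun j => x i j ω) (fun j => x i j ω) t) ∧
        ‖lsEstimate (fun j => x i j ω) (fun j => y i j ω) t - Θ‖ ≤
          constC1 n l σx ση μhat δ / (√((t : ℕ) : ℝ) * σx ^ 2 * lam)} := by
    rintro ω ⟨h1, h2⟩
    obtain ⟨hU, hle⟩ := isUnit_and_norm_lsEstimate_sub_le Θ (fun j => x i j ω)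
      (fun j => η i j ω) (fun j => y i j ω) t (fun j => hy i j ω) hc0 hK0 h1 h2
    refine ⟨hU, hle.trans (le_of_eq ?_)⟩
    have hs : 0 < √((t : ℕ) : ℝ) := Real.sqrt_pos.2 ht0
    rw [hK, hc]
    nth_rw 2 [← Real.mul_self_sqrt ht0.le]
    field_simp
  refine le_trans ?_ (measure_mono hsub)
  -- The samples are only a.e. measurable, so subadditivity replaces the complement formula.
  have hone : 1 ≤ P ((fun ω (j : Finset.Icc 1 t) => (x i j ω, η i j ω)) ⁻¹' G)
      + P ((fun ω (j : Finset.Icc 1 t) => (x i j ω, η i j ω)) ⁻¹' Gᶜ) := by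
    rw [← measure_univ (μ := P), ← Set.union_compl_self
      ((fun ω (j : Finset.Icc 1 t) => (x i j ω, η i j ω)) ⁻¹' G), ← Set.preimage_compl]
    exact measure_union_le _ _
  rw [ENNReal.ofReal_sub _ (by positivity), ENNReal.ofReal_one]
  exact tsub_le_iff_right.2 (hone.trans (by gcongr))
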